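/- **Patterns.** A permutation pattern $p$ of length $m\ge 1$ is a permutation $p_1\cdots p_m$ in which some pairs of consecutive entries are connected by an underline. It occurs in a permutation $\pi$ at positions $i_1<\dots<i_m$ if $\pi_{i_1}\cdots\pi_{i_m}$ is order isomorphic to $p$ and $i_{j+1}=i_j+1$ whenever $p_j,p_{j+1}$ are connected by an underline; $p(\pi)$ is the number of occurrences. The empty pattern $\emptyset$ is also allowed, with the convention that it never occurs. For a set $A$ of patterns and a pattern $p$ put $$F^{A,p}(t,z)=1+\sum_{n\ge1}\frac{t^n}{n!}\sum_{\pi} z^{p(\pi)},$$ where $\pi$ runs over the permutations of length $n$ in which no pattern of $A$ occurs. **$k$-Stirling permutations.** Let $k\ge1$. A $k$-Stirling permutation of order $n$ is a rearrangement $\sigma$ of the multiset $\{1^k,\dots,n^k\}$ such that every element between two consecutive occurrences of $i$ is greater than $i$, for each $i$. The block $[i,i]_\sigma$ is the segment of $\sigma$ from the first to the last occurrence of $i$, and $(i,i)_\sigma$ is $[i,i]_\sigma$ with all $i$'s removed. A block is of level 1 if it is contained in no other block. For $\ell\ge2$, $[i,i]_\sigma$ is of level $\ell$ if it is contained in a level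 $\ell-1$ block $[h,h]_\sigma$, $h\neq i$ (its parent), and is a level 1 block of the word $(h,h)_\sigma$; it is of type $s\in\{1,\dots,k-1\}$ if it lies between the $s$th and the $(s+1)$st occurrences of $h$. Two blocks are siblings if both are of level 1, or if they have the same parent and the same type. A pattern $p$ of length $m\ge 1$ occurs as a block pattern in $\sigma$ at siblings $[b_1,b_1]_\sigma,\dots,[b_m,b_m]_\sigma$, appearing from left to right, if $b_1\cdots b_m$ is order isomorphic to $p$ and the last $b_j$ is immediately followed by the first $b_{j+1}$ whenever $p_j,p_{j+1}$ are connected by an underline. Let $p^{(1)}(\sigma)$ and $p^{(\ell,s)}(\sigma)$ be the numbers of such occurrences at level 1, respectively at level $\ell\ge2$ and type $s$, and let $\mathrm{bl}^{(1)}(\sigma)$, $\mathrm{bl}^{(\ell,s)}(\sigma)$ be the corresponding numbers of blocks. **Generating function.** Let $\tilde A=(A_1,(A_{2,1},\dots,A_{2,k-1}),(A_{3,1},\dots,A_{3,k-1}),\dots)$ consist of sets of patterns, let $\tilde p$ be a sequence of the same shape consisting of patterns, and let $\tilde x,\tilde y$ be sequences of the same shape consisting of variables (or of elements of a commutative $\mathbb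 Q$-algebra). Put $$G_k^{\tilde A,\tilde p}(t;\tilde x;\tilde y)=1+\sum_{n\ge1}\frac{t^n}{n!}\sum_{\sigma}x_1^{p_1^{(1)}(\sigma)}y_1^{\mathrm{bl}^{(1)}(\sigma)}\prod_{i\ge2}\prod_{j=1}^{k-1}x_{i,j}^{p_{i,j}^{(i,j)}(\sigma)}y_{i,j}^{\mathrm{bl}^{(i,j)}(\sigma)},$$ where $\sigma$ runs over the $k$-Stirling permutations of order $n$ in which no pattern of $A_1$ occurs at level 1 and no pattern of $A_{i,j}$ occurs at level $i$ and type $j$. For a sequence $\tilde s$ of the above shape let $\mathrm{sh}_j\tilde s=(s_{2,j},(s_{3,1},\dots,s_{3,k-1}),(s_{4,1},\dots,s_{4,k-1}),\dots)$. **Theorem.** As formal power series in $t$, $$G_k^{\tilde A,\tilde p}(t;\tilde x;\tilde y)=F^{A_1,p_1}\Bigl(y_1\int_0^t\prod_{j=1}^{k-1}G_k^{\mathrm{sh}_j\tilde A,\,\mathrm{sh}_j\tilde p}(u;\mathrm{sh}_j\tilde x;\mathrm{sh}_j\tilde y)\,du,\;x_1\Bigr).$$ For $k=2$ this reduces to the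 following statement on Stirling permutations. Let $A,p,x,y$ be sequences (of sets of patterns, of patterns, of variables and of variables). Call two blocks of a 2-Stirling permutation siblings if both are of level 1 or they have the same parent, and let $p^{(i)}(\sigma)$ and $\mathrm{bl}^{(i)}(\sigma)$ be the numbers of occurrences of $p$ as a block pattern at level $i$ and of blocks of level $i$. Let $$G^{A,p}(t;x;y)=1+\sum_{n\ge1}\frac{t^n}{n!}\sum_\sigma\prod_{i\ge1}x_i^{p_i^{(i)}(\sigma)}y_i^{\mathrm{bl}^{(i)}(\sigma)},$$ where $\sigma$ runs over the 2-Stirling permutations of order $n$ in which no pattern of $A_i$ occurs at level $i$, for all $i\ge 1$. Then $G^{A,p}(t;x;y)$ equals $G_2$ of the same sequences, their terms of index $\ge2$ being read as 1-tuples, and $$G^{A,p}(t;x;y)=F^{A_1,p_1}\Bigl(y_1\int_0^tG^{\mathrm{sh}A,\,\mathrm{sh}p}(u;\mathrm{sh}\,x;\mathrm{sh}\,y)\,du,\;x_1\Bigr),\qquad \mathrm{sh}(s_1,s_2,\dots)=(s_2,s_3,\dots).$$ -/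

import Mathlib

open scoped PowerSeries

/-! ### Permutation patterns -/

/-- A permutation pattern: a permutation `perm` of length `len`, some of whose consecutive entries
are underlined. `j ∈ underline` says that the entries with (zero-based) indices `j` and `j + 1`
are connected by an underline. The case `len = 0` is the empty pattern `∅`, which is used as a
placeholder for "no pattern": it never occurs in anything. -/
structure PermPattern where
  len : ℕ
  perm : Equiv.Perm (Fin len)
  underline : Set (Fin (len - 1))

namespace PermPattern

/-- `b` is order isomorphic to `p`, i.e. the reduced form of `b` is `p` without its underlines. -/
def OrderIso (p : PermPattern) (b : Fin p.len → ℕ) : Prop :=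
  ∀ a c : Fin p.len, b a < b c ↔ p.perm a < p.perm c

/-- The entries of `p` with indices `a` and `c` are adjacent, `a` before `c`, and connected by an
underline. -/
def Linked (p : PermPattern) (a c : Fin p.len) : Prop :=
  ∃ j ∈ p.underline, (a : ℕ) = j ∧ (c : ℕ) = j + 1

/-- `i` lists the (increasing) positions of an occurrence of `p` in the word `w` of length `n`. -/
def IsOcc (p : PermPattern) {n : ℕ} (w : Fin n → ℕ) (i : Fin p.len → Fin n) : Prop :=
  0 < p.len ∧ StrictMono i ∧ p.OrderIso (fun a => w (i a)) ∧
    ∀ a c, p.Linked a c → (i c : ℕ) = (i a : ℕ) + 1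

/-- The number `p(π)` of occurrences of `p` in the permutation `π`. -/
noncomputable def occ (p : PermPattern) {n : ℕ} (π : Equiv.Perm (Fin n)) : ℕ :=
  {i : Fin p.len → Fin n | p.IsOcc (fun a => (π a : ℕ)) i}.ncard

end PermPattern

open Classical in
/-- The permutations of length `n` that avoid all the patterns of `A`. -/
noncomputable def avoidingPerms (A : Set PermPattern) (n : ℕ) : Finset (Equiv.Perm (Fin n)) :=
  {π | ∀ a ∈ A, a.occ π = 0}

/-- The exponential generating function
`F^{A,p}(t, z) = 1 + ∑_{n ≥ 1} (t^n / n!) ∑_π z^{p(π)}`, the inner sum being over the permutations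
`π` of length `n` that avoid `A`, as a power series in `t`. -/
noncomputable def permEGF {R : Type*} [CommRing R] [Algebra ℚ R]
    (A : Set PermPattern) (p : PermPattern) (z : R) : R⟦X⟧ :=
  PowerSeries.mk fun n =>
    if n = 0 then 1
    else algebraMap ℚ R (1 / (n.factorial : ℚ)) * ∑ π ∈ avoidingPerms A n, z ^ p.occ π

/-! ### `k`-Stirling permutations and their blocks -/

/-- The word `1 ⋯ 1 2 ⋯ 2 ⋯ n ⋯ n` in which each of `1, …, n` is repeated `k` times. -/
def sortedWord (k n : ℕ) : List ℕ :=
  (List.range n).flatMap fun i => List.replicate k (i + 1)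

/-- Every element between two consecutive occurrences of a letter `i` is greater than `i`. -/
def IsStirlingWord (σ : List ℕ) : Prop :=
  ∀ a c : Fin σ.length, a < c → σ[a] = σ[c] →
    (∀ b : Fin σ.length, a < b → b < c → σ[b] ≠ σ[a]) →
    ∀ b : Fin σ.length, a < b → b < c → σ[a] < σ[b]

open Classical in
/-- The set `𝒬_{n,k}` of `k`-Stirling permutations of order `n`. -/
noncomputable def kStirling (k n : ℕ) : Finset (List ℕ) :=
  {σ ∈ (sortedWord k n).permutations.toFinset | IsStirlingWord σ}

/-- `[i,i]_σ`: the consecutive segment of `σ` from the first to the last occurrence of `i`. -/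
def block (σ : List ℕ) (i : ℕ) : List ℕ :=
  (σ.dropWhile (· ≠ i)).rdropWhile (· ≠ i)

/-- `(i,i)_σ`: the word `[i,i]_σ` with all occurrences of `i` removed. -/
def blockInterior (σ : List ℕ) (i : ℕ) : List ℕ :=
  (block σ i).filter (· ≠ i)

/-- `[i,i]_σ ⊂ [j,j]_σ`, for letters `i ≠ j` of `σ`. -/
def BlockSub (σ : List ℕ) (i j : ℕ) : Prop :=
  i ∈ σ ∧ i ≠ j ∧ block σ i <:+: block σ j

/-- `[i,i]_σ` is a level 1 block of `σ`: it is contained in no other block. -/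
def IsLevelOne (σ : List ℕ) (i : ℕ) : Prop :=
  i ∈ σ ∧ ∀ j ∈ σ, ¬ BlockSub σ i j

/-- `IsLevel σ ℓ i`: `[i,i]_σ` is a level `ℓ` block of `σ`. For `ℓ ≥ 2` this means that it lies in
a level `ℓ - 1` block `[j,j]_σ` and is a level 1 block of the word `(j,j)_σ`. (Replacing that word
by its reduced form changes nothing, as only containment of blocks matters.) -/
def IsLevel (σ : List ℕ) : ℕ → ℕ → Prop
  | 0, _ => False
  | 1, i => IsLevelOne σ i
  | ℓ + 2, i => ∃ j ∈ σ, IsLevel σ (ℓ + 1) j ∧ BlockSub σ i j ∧ IsLevelOne (blockInterior σ j) i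

/-- `[h,h]_σ` is the parent of `[i,i]_σ`. -/
def IsParent (σ : List ℕ) (h i : ℕ) : Prop :=
  BlockSub σ i h ∧ ∃ ℓ, IsLevel σ ℓ h ∧ IsLevel σ (ℓ + 1) i

/-- `[i,i]_σ` is of type `s`: it lies between the `s`th and the `(s+1)`st occurrences of `h`, where
`[h,h]_σ` is its parent; that is, exactly `s` occurrences of `h` precede the first `i`. -/
def HasType (σ : List ℕ) (i s : ℕ) : Prop :=
  ∃ h, IsParent σ h i ∧ (σ.takeWhile (· ≠ i)).count h = s

/-- Siblings among the blocks of a Stirling permutation: two level 1 blocks, or two blocks with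
the same parent. -/
def Sibling (σ : List ℕ) (i j : ℕ) : Prop :=
  (IsLevel σ 1 i ∧ IsLevel σ 1 j) ∨ ∃ h, IsParent σ h i ∧ IsParent σ h j

/-- Siblings among the blocks of a `k`-Stirling permutation: two level 1 blocks, or two blocks with
the same parent and of the same type. -/
def KSibling (σ : List ℕ) (i j : ℕ) : Prop :=
  (IsLevel σ 1 i ∧ IsLevel σ 1 j) ∨
    ((∃ h, IsParent σ h i ∧ IsParent σ h j) ∧ ∃ s, HasType σ i s ∧ HasType σ j s)

/-- The blocks of the letters `b` form an occurrence of the block pattern `p` in `σ`, with respect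
to the sibling relation `sib`: they are siblings, appear from left to right, their letters are
order isomorphic to `p`, and for underlined neighbours the first occurrence of the later letter
is immediately after the last occurrence of the earlier one (the block `[i,i]_σ` occupies the
`(block σ i).length` positions from `σ.idxOf i` on). -/
def IsBlockOcc (sib : ℕ → ℕ → Prop) (σ : List ℕ) (p : PermPattern) (b : Fin p.len → ℕ) : Prop :=
  0 < p.len ∧ (∀ a, b a ∈ σ) ∧ (∀ a c, sib (b a) (b c)) ∧
    StrictMono (fun a => σ.idxOf (b a)) ∧ p.OrderIso b ∧
    ∀ a c, p.Linked a c → σ.idxOf (b c) = σ.idxOf (b a) + (block σ (b a)).length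

/-! ### Sequences of tuples -/

/-- A sequence `s_1, (s_{2,1}, …, s_{2,k-1}), (s_{3,1}, …, s_{3,k-1}), …`. Indices are zero-based:
`head` is `s_1` and `tail i j` is `s_{i+2,j+1}`. -/
structure TupleSeq (k : ℕ) (α : Type*) where
  head : α
  tail : ℕ → Fin (k - 1) → α

/-- `sh_j s = s_{2,j}, (s_{3,1}, …, s_{3,k-1}), …` -/
def TupleSeq.shift {k : ℕ} {α : Type*} (j : Fin (k - 1)) (s : TupleSeq k α) : TupleSeq k α where
  head := s.tail 0 j
  tail i := s.tail (i + 1)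

/-- A sequence `s_1, s_2, …` (here `s 0, s 1, …`) as a sequence of 1-tuples, for `k = 2`. -/
def TupleSeq.ofSeq {α : Type*} (s : ℕ → α) : TupleSeq 2 α where
  head := s 0
  tail i _ := s (i + 1)

/-! ### The generating function for `k`-Stirling permutations -/

/-- `p^{(1)}(σ)`: the number of occurrences of the block pattern `p` at level 1. -/
noncomputable def kOccOne (σ : List ℕ) (p : PermPattern) : ℕ :=
  {b : Fin p.len → ℕ | IsBlockOcc (KSibling σ) σ p b ∧ ∀ a, IsLevel σ 1 (b a)}.ncard

/-- `p^{(ℓ,s)}(σ)`: the number of occurrences of the block pattern `p` at level `ℓ`, type `s`. -/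
noncomputable def kOcc (σ : List ℕ) (ℓ s : ℕ) (p : PermPattern) : ℕ :=
  {b : Fin p.len → ℕ | IsBlockOcc (KSibling σ) σ p b ∧
    ∀ a, IsLevel σ ℓ (b a) ∧ HasType σ (b a) s}.ncard

/-- `bl^{(ℓ)}(σ)`: the number of level `ℓ` blocks. -/
noncomputable def numBlocks (σ : List ℕ) (ℓ : ℕ) : ℕ :=
  {i : ℕ | IsLevel σ ℓ i}.ncard

/-- `bl^{(ℓ,s)}(σ)`: the number of level `ℓ` blocks of type `s`. -/
noncomputable def numBlocksOfType (σ : List ℕ) (ℓ s : ℕ) : ℕ :=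
  {i : ℕ | IsLevel σ ℓ i ∧ HasType σ i s}.ncard

open Classical in
/-- `𝒬_{n,k}(A)`: the `k`-Stirling permutations of order `n` that avoid the patterns of `A_1` at
level 1 and those of `A_{i,j}` among the blocks of level `i` and type `j`. -/
noncomputable def kStirlingAvoiding (k n : ℕ) (A : TupleSeq k (Set PermPattern)) :
    Finset (List ℕ) :=
  {σ ∈ kStirling k n | (∀ a ∈ A.head, kOccOne σ a = 0) ∧
    ∀ (i : ℕ) (j : Fin (k - 1)), ∀ a ∈ A.tail i j, kOcc σ (i + 2) (j + 1) a = 0}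

/-- The weight `x_1^{p_1^{(1)}(σ)} y_1^{bl^{(1)}(σ)} ∏_{i ≥ 2} ∏_{j=1}^{k-1}
x_{i,j}^{p_{i,j}^{(i,j)}(σ)} y_{i,j}^{bl^{(i,j)}(σ)}`. Only finitely many factors differ from 1,
since `σ` has finitely many blocks. -/
noncomputable def kWeight {R : Type*} [CommRing R] (k : ℕ) (p : TupleSeq k PermPattern)
    (x y : TupleSeq k R) (σ : List ℕ) : R :=
  x.head ^ kOccOne σ p.head * y.head ^ numBlocks σ 1 *
    ∏ᶠ i : ℕ, ∏ j : Fin (k - 1),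
      x.tail i j ^ kOcc σ (i + 2) (j + 1) (p.tail i j) *
        y.tail i j ^ numBlocksOfType σ (i + 2) (j + 1)

/-- The exponential generating function `G_k^{A,p}(t; x; y)`, as a power series in `t`. -/
noncomputable def kStirlingEGF {R : Type*} [CommRing R] [Algebra ℚ R] (k : ℕ)
    (A : TupleSeq k (Set PermPattern)) (p : TupleSeq k PermPattern) (x y : TupleSeq k R) : R⟦X⟧ :=
  PowerSeries.mk fun n =>
    if n = 0 then 1
    else algebraMap ℚ R (1 / (n.factorial : ℚ)) * ∑ σ ∈ kStirlingAvoiding k n A, kWeight k p x y σ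

/-! ### The generating function for Stirling permutations (no types) -/

/-- `p^{(ℓ)}(σ)`: the number of occurrences of the block pattern `p` at level `ℓ`, where siblings
need not have the same type. -/
noncomputable def levelOcc (σ : List ℕ) (ℓ : ℕ) (p : PermPattern) : ℕ :=
  {b : Fin p.len → ℕ | IsBlockOcc (Sibling σ) σ p b ∧ ∀ a, IsLevel σ ℓ (b a)}.ncard

open Classical in
/-- `𝒬_n(A)`: the Stirling permutations of order `n` that for each level `i ≥ 1` avoid the patterns
of `A_i` at level `i`. Here and below `A_i` is `A (i - 1)`, and similarly for other sequences. -/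
noncomputable def stirlingAvoiding (n : ℕ) (A : ℕ → Set PermPattern) : Finset (List ℕ) :=
  {σ ∈ kStirling 2 n | ∀ i : ℕ, ∀ a ∈ A i, levelOcc σ (i + 1) a = 0}

/-- The exponential generating function `G^{A,p}(t; x; y) = 1 + ∑_{n ≥ 1} (t^n / n!)
∑_{σ ∈ 𝒬_n(A)} ∏_{i ≥ 1} x_i^{p_i^{(i)}(σ)} y_i^{bl^{(i)}(σ)}`, as a power series in `t`. -/
noncomputable def stirlingEGF {R : Type*} [CommRing R] [Algebra ℚ R]
    (A : ℕ → Set PermPattern) (p : ℕ → PermPattern) (x y : ℕ → R) : R⟦X⟧ :=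
  PowerSeries.mk fun n =>
    if n = 0 then 1
    else algebraMap ℚ R (1 / (n.factorial : ℚ)) *
      ∑ σ ∈ stirlingAvoiding n A,
        ∏ᶠ i : ℕ, x i ^ levelOcc σ (i + 1) (p i) * y i ^ numBlocks σ (i + 1)

/-- The formal integral `∫_0^t f(u) du` of a power series. -/
noncomputable def formalIntegral {R : Type*} [CommRing R] [Algebra ℚ R] (f : R⟦X⟧) : R⟦X⟧ :=
  PowerSeries.mk fun n =>
    if n = 0 then 0 else algebraMap ℚ R (1 / (n : ℚ)) * PowerSeries.coeff (n - 1) f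

/-!
Cutting a `k`-Stirling word into its level 1 blocks writes it uniquely as a sequence of blocks
`b w₁ b w₂ b ⋯ w_{k-1} b` on disjoint sets of letters, where `b` is the least letter of its block
and the gaps `w₁, …, w_{k-1}` are again `k`-Stirling words on disjoint sets of letters. A block of
level `ℓ` in a gap has level `ℓ + 1` in the whole word and keeps its type, except that the level 1
blocks of `w_s` become the level 2 blocks of type `s`. The weight of a word is therefore the weight
of its sequence of letters `b` times the weights of all gaps, for the shifted parameters.

Distributing letters over disjoint sets multiplies exponential generating functions, and splitting
off the least letter of a block integrates, so a single block contributes the integral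
`H = ∫ ∏ₛ G_s`. The blocks of a word may be permuted without changing their gaps; averaging over the
`m!` orders of `m` blocks replaces the pattern statistic of the sequence of letters `b` by the
coefficient of `F` at `t ^ m`, independently of the blocks. Summing `[t ^ m] F * (y * H) ^ m` over
`m` is the substitution of `y * H` into `F`.
-/

/-! ### Products of exponential generating functions -/

section EGF

variable {R : Type*} [CommSemiring R]

/-- `n!` times the coefficient of `t ^ n`: the sequence of which `G` is the exponential
generating function. -/
noncomputable def egfCoeff (G : R⟦X⟧) (n : ℕ) : R := (n.factorial : R) * PowerSeries.coeff n G

lemma egfCoeff_succ (G : R⟦X⟧) (n : ℕ) :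
    egfCoeff G (n + 1) = egfCoeff (PowerSeries.derivative (R := R) G) n := by
  rw [egfCoeff, egfCoeff, PowerSeries.coeff_derivative, Nat.factorial_succ]
  push_cast
  ring

lemma egfCoeff_sum {ι : Type*} (s : Finset ι) (G : ι → R⟦X⟧) (n : ℕ) :
    egfCoeff (∑ i ∈ s, G i) n = ∑ i ∈ s, egfCoeff (G i) n := by
  simp only [egfCoeff, map_sum, Finset.mul_sum]

lemma derivation_prod_eq_sum_update {A : Type*} [CommSemiring A] [Algebra R A]
    (D : Derivation R A A) {ι : Type*} [DecidableEq ι] (s : Finset ι) (G : ι → A) :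
    D (∏ i ∈ s, G i) = ∑ j ∈ s, ∏ i ∈ s, Function.update G j (D (G j)) i := by
  induction s using Finset.induction_on with
  | empty => simp
  | insert a s ha ih =>
    have update_a : ∏ i ∈ insert a s, Function.update G a (D (G a)) i =
        (∏ i ∈ s, G i) * D (G a) := by
      rw [Finset.prod_update_of_mem (Finset.mem_insert_self a s), Finset.sdiff_singleton_eq_erase,
        Finset.erase_insert ha, mul_comm]
    have update_of_mem : ∀ j ∈ s, ∏ i ∈ insert a s, Function.update G j (D (G j)) i =
        G a * ∏ i ∈ s, Function.update G j (D (G j)) i := fun j hj => by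
      rw [Finset.prod_insert ha, Function.update_of_ne (ne_of_mem_of_not_mem hj ha).symm]
    rw [Finset.prod_insert ha, Derivation.leibniz, ih, Finset.sum_insert ha, update_a,
      Finset.sum_congr rfl update_of_mem, ← Finset.mul_sum, smul_eq_mul, smul_eq_mul, add_comm]

variable {ι : Type*} [Fintype ι] [DecidableEq ι]

lemma sum_fin_prod_egfCoeff (n : ℕ) (G : ι → R⟦X⟧) :
    ∑ f : Fin n → ι, ∏ i, egfCoeff (G i) (Finset.univ.filter fun a => f a = i).card =
      egfCoeff (∏ i, G i) n := by
  induction n generalizing G with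
  | zero => simp [egfCoeff, map_prod]
  | succ n ih =>
    -- The value `j` of `f` at `0` selects the factor that is differentiated.
    rw [egfCoeff_succ, derivation_prod_eq_sum_update, egfCoeff_sum,
      ← (Fin.consEquiv fun _ => ι).sum_comp, Fintype.sum_prod_type]
    refine Finset.sum_congr rfl fun j _ => ?_
    rw [← ih]
    refine Finset.sum_congr rfl fun f _ => Finset.prod_congr rfl fun i _ => ?_
    rw [Fin.card_filter_univ_succ']
    simp only [Fin.consEquiv, Equiv.coe_fn_mk, Fin.cons_zero, Fin.cons_succ]
    by_cases h : j = i
    · subst h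
      rw [if_pos rfl, Function.update_self, ← egfCoeff_succ, add_comm]
    · rw [if_neg h, zero_add, Function.update_of_ne (Ne.symm h)]

lemma sum_prod_egfCoeff {α : Type*} [Fintype α] [DecidableEq α] (G : ι → R⟦X⟧) :
    ∑ f : α → ι, ∏ i, egfCoeff (G i) (Finset.univ.filter fun a => f a = i).card =
      egfCoeff (∏ i, G i) (Fintype.card α) := by
  rw [← sum_fin_prod_egfCoeff]
  refine Fintype.sum_equiv ((Fintype.equivFin α).arrowCongr (Equiv.refl ι)) _ _ fun f => ?_
  refine Finset.prod_congr rfl fun i _ => congrArg _ ?_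
  exact Finset.card_equiv (Fintype.equivFin α) (by simp)

end EGF

section EGFSubst

variable {R : Type*} [CommRing R]

lemma coeff_subst_eq_sum_range {F a : R⟦X⟧} (ha : PowerSeries.constantCoeff a = 0) (n : ℕ) :
    PowerSeries.coeff n (F.subst a) =
      ∑ m ∈ Finset.range (n + 1), PowerSeries.coeff m F * PowerSeries.coeff n (a ^ m) := by
  rw [PowerSeries.coeff_subst' (PowerSeries.HasSubst.of_constantCoeff_zero' ha)]
  refine finsum_eq_sum_of_support_subset _ fun m hm => ?_
  rw [Finset.coe_range, Set.mem_Iio]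
  contrapose! hm
  rw [Function.notMem_support, smul_eq_mul, PowerSeries.coeff_of_lt_order n ?_, mul_zero]
  exact (Nat.cast_lt.2 hm).trans_le (PowerSeries.le_order_pow_of_constantCoeff_eq_zero m ha)

lemma egfCoeff_subst_C_mul (F : R⟦X⟧) {H : R⟦X⟧} (hH : PowerSeries.constantCoeff H = 0) (y : R)
    (n : ℕ) :
    egfCoeff (F.subst (PowerSeries.C y * H)) n =
      ∑ m ∈ Finset.range (n + 1), PowerSeries.coeff m F * (y ^ m * egfCoeff (H ^ m) n) := by
  rw [egfCoeff, coeff_subst_eq_sum_range (by rw [map_mul, hH, mul_zero]), Finset.mul_sum]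
  refine Finset.sum_congr rfl fun m _ => ?_
  rw [mul_pow, ← map_pow, PowerSeries.coeff_C_mul, egfCoeff]
  ring

end EGFSubst

section EGFAlgebra

variable {R : Type*} [CommRing R] [Algebra ℚ R]

lemma natCast_mul_algebraMap_one_div {n : ℕ} (hn : n ≠ 0) :
    (n : R) * algebraMap ℚ R (1 / (n : ℚ)) = 1 := by
  rw [← map_natCast (algebraMap ℚ R) n, ← map_mul, mul_one_div_cancel (Nat.cast_ne_zero.2 hn),
    map_one]

lemma ext_egfCoeff {G H : R⟦X⟧} (h : ∀ n, egfCoeff G n = egfCoeff H n) : G = H :=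
  PowerSeries.ext fun n => (IsUnit.natCast_factorial_of_algebra ℚ n).mul_left_cancel (h n)

lemma egfCoeff_mk_ite {c : ℕ → R} (hc : c 0 = 1) (n : ℕ) :
    egfCoeff (PowerSeries.mk fun n =>
      if n = 0 then 1 else algebraMap ℚ R (1 / (n.factorial : ℚ)) * c n) n = c n := by
  rw [egfCoeff, PowerSeries.coeff_mk]
  split_ifs with hn
  · rw [hn, hc, Nat.factorial_zero, Nat.cast_one, one_mul]
  · rw [← mul_assoc, natCast_mul_algebraMap_one_div n.factorial_ne_zero, one_mul]

lemma constantCoeff_formalIntegral (G : R⟦X⟧) :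
    PowerSeries.constantCoeff (formalIntegral G) = 0 := by
  rw [← PowerSeries.coeff_zero_eq_constantCoeff_apply, formalIntegral, PowerSeries.coeff_mk,
    if_pos rfl]

lemma egfCoeff_formalIntegral_zero (G : R⟦X⟧) : egfCoeff (formalIntegral G) 0 = 0 := by
  rw [egfCoeff, PowerSeries.coeff_zero_eq_constantCoeff_apply, constantCoeff_formalIntegral,
    mul_zero]

lemma egfCoeff_formalIntegral_succ (G : R⟦X⟧) (n : ℕ) :
    egfCoeff (formalIntegral G) (n + 1) = egfCoeff G n := by
  rw [egfCoeff, formalIntegral, PowerSeries.coeff_mk, if_neg n.succ_ne_zero, egfCoeff,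
    Nat.factorial_succ, Nat.cast_mul, Nat.add_sub_cancel]
  linear_combination (n.factorial : R) * PowerSeries.coeff n G *
    natCast_mul_algebraMap_one_div (R := R) n.succ_ne_zero

end EGFAlgebra

/-! ### Families of structures whose supports partition a set -/

section Families

variable {ι α β : Type*} [DecidableEq ι] {S : Finset α}

/-- The elements of `S` that `f` sends to `i`: the parts of the partition of `S` described by
`f`. -/
def fiberFinset (f : S → ι) (i : ι) : Finset α :=
  (Finset.univ.filter fun a => f a = i).map (Function.Embedding.subtype _)

lemma mem_fiberFinset {f : S → ι} {i : ι} {a : α} :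
    a ∈ fiberFinset f i ↔ ∃ h : a ∈ S, f ⟨a, h⟩ = i := by
  simp [fiberFinset]

lemma fiberFinset_subset (f : S → ι) (i : ι) : fiberFinset f i ⊆ S :=
  fun _ ha => (mem_fiberFinset.1 ha).1

lemma fiberFinset_injective : Function.Injective (fiberFinset : (S → ι) → ι → Finset α) := by
  intro f f' h
  funext a
  have ha : (a : α) ∈ fiberFinset f (f a) := mem_fiberFinset.2 ⟨a.2, rfl⟩
  rw [h, mem_fiberFinset] at ha
  exact ha.2.symm

lemma exists_fiberFinset_eq {T : ι → Finset α} (hdisj : ∀ a i j, a ∈ T i → a ∈ T j → i = j)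
    (hcover : ∀ a, a ∈ S ↔ ∃ i, a ∈ T i) : ∃ f : S → ι, ∀ i, fiberFinset f i = T i := by
  choose f hf using fun a : S => (hcover a).1 a.2
  refine ⟨f, fun i => Finset.ext fun a => ?_⟩
  rw [mem_fiberFinset]
  constructor
  · rintro ⟨ha, rfl⟩
    exact hf ⟨a, ha⟩
  · intro ha
    have haS := (hcover a).2 ⟨i, ha⟩
    exact ⟨haS, hdisj a _ _ (hf ⟨a, haS⟩) ha⟩

open Classical in
/-- Families `g` of structures such that `g i` is a structure on a set `T i` (that is, an element
of `C i (T i)`), where the sets `T i` partition `S`: the product of the species `C i`. -/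
noncomputable def families [Fintype ι] (C : ι → Finset α → Finset β) (S : Finset α) :
    Finset (ι → β) :=
  Finset.univ.biUnion fun f : S → ι => Fintype.piFinset fun i => C i (fiberFinset f i)

variable [Fintype ι] {C : ι → Finset α → Finset β} {supp : β → Finset α}

lemma mem_families_iff_exists_fiberFinset {g : ι → β} :
    g ∈ families C S ↔ ∃ f : S → ι, ∀ i, g i ∈ C i (fiberFinset f i) := by
  simp only [families, Finset.mem_biUnion, Finset.mem_univ, true_and, Fintype.mem_piFinset]

lemma mem_families (hC : ∀ i T, ∀ b ∈ C i T, supp b = T) {g : ι → β} :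
    g ∈ families C S ↔ (∀ i, g i ∈ C i (supp (g i))) ∧
      (∀ a i j, a ∈ supp (g i) → a ∈ supp (g j) → i = j) ∧
      ∀ a, a ∈ S ↔ ∃ i, a ∈ supp (g i) := by
  rw [mem_families_iff_exists_fiberFinset]
  constructor
  · rintro ⟨f, hf⟩
    have supp_eq : ∀ i, supp (g i) = fiberFinset f i := fun i => hC i _ _ (hf i)
    simp only [supp_eq, mem_fiberFinset]
    refine ⟨hf, ?_, fun a => ⟨fun ha => ⟨_, ha, rfl⟩, fun ⟨_, ha, _⟩ => ha⟩⟩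
    rintro a i j ⟨_, rfl⟩ ⟨_, rfl⟩
    rfl
  · rintro ⟨hg, hdisj, hcover⟩
    obtain ⟨f, hf⟩ := exists_fiberFinset_eq hdisj hcover
    exact ⟨f, fun i => hf i ▸ hg i⟩

lemma sum_families {R : Type*} [CommSemiring R] (hC : ∀ i T, ∀ b ∈ C i T, supp b = T)
    (v : ι → β → R) (G : ι → R⟦X⟧)
    (hG : ∀ i, ∀ T ⊆ S, ∑ b ∈ C i T, v i b = egfCoeff (G i) T.card) :
    ∑ g ∈ families C S, ∏ i, v i (g i) = egfCoeff (∏ i, G i) S.card := by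
  classical
  have hdisj : Set.PairwiseDisjoint (↑(Finset.univ : Finset (S → ι)) : Set (S → ι))
      (fun f => Fintype.piFinset fun i => C i (fiberFinset f i)) := by
    intro f _ f' _ hne
    rw [Function.onFun, Finset.disjoint_left]
    intro g hg hg'
    rw [Fintype.mem_piFinset] at hg hg'
    exact hne (fiberFinset_injective (funext fun i =>
      (hC i _ _ (hg i)).symm.trans (hC i _ _ (hg' i))))
  rw [families, Finset.sum_biUnion hdisj, ← Fintype.card_coe S, ← sum_prod_egfCoeff]
  refine Finset.sum_congr rfl fun f _ => ?_
  rw [← Finset.prod_univ_sum]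
  refine Finset.prod_congr rfl fun i _ => ?_
  rw [hG i _ (fiberFinset_subset f i), fiberFinset, Finset.card_map]

lemma comp_perm_mem_families {C : Finset α → Finset β} {g : ι → β}
    (hg : g ∈ families (fun _ => C) S) (ρ : Equiv.Perm ι) :
    g ∘ ρ ∈ families (fun _ => C) S := by
  rw [mem_families_iff_exists_fiberFinset] at hg ⊢
  obtain ⟨f, hf⟩ := hg
  refine ⟨ρ.symm ∘ f, fun i => ?_⟩
  have : fiberFinset (ρ.symm ∘ f) i = fiberFinset f (ρ i) := by
    ext a
    simp only [mem_fiberFinset, Function.comp_apply, Equiv.symm_apply_eq]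
  rw [this]
  exact hf (ρ i)

lemma sum_families_comp_perm {M : Type*} [AddCommMonoid M] (C : Finset α → Finset β)
    (ρ : Equiv.Perm ι) (F : (ι → β) → M) :
    ∑ g ∈ families (fun _ => C) S, F (g ∘ ρ) = ∑ g ∈ families (fun _ => C) S, F g :=
  Finset.sum_bij' (fun g _ => g ∘ ρ) (fun g _ => g ∘ ρ.symm)
    (fun _ hg => comp_perm_mem_families hg ρ) (fun _ hg => comp_perm_mem_families hg ρ.symm)
    (fun _ _ => funext fun i => by simp) (fun _ _ => funext fun i => by simp) fun _ _ => rfl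

end Families

/-! ### Symmetrization of pattern statistics -/

namespace PermPattern

variable (p : PermPattern) {m : ℕ}

/-- The number of occurrences of `p` in a word; `p.occ π` is the case where the word is the
permutation `π`. -/
noncomputable def numOcc (b : Fin m → ℕ) : ℕ := {i : Fin p.len → Fin m | p.IsOcc b i}.ncard

lemma numOcc_congr {b c : Fin m → ℕ} (h : ∀ i j, b i < b j ↔ c i < c j) :
    p.numOcc b = p.numOcc c := by
  simp only [numOcc, IsOcc, OrderIso, h]

lemma numOcc_fin_zero (b : Fin 0 → ℕ) : p.numOcc b = 0 := by
  rw [numOcc, Set.ncard_eq_zero]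
  exact Set.eq_empty_of_forall_notMem fun i hi => (i ⟨0, hi.1⟩).elim0

end PermPattern

open Classical in
/-- The contribution of a word `b` to `F^{A,p}(t,z)`: `z` to the power of the number of occurrences
of `p`, or `0` if some pattern of `A` occurs. -/
noncomputable def patternWeight {R : Type*} [CommSemiring R] (A : Set PermPattern)
    (p : PermPattern) (z : R) {m : ℕ} (b : Fin m → ℕ) : R :=
  if ∀ a ∈ A, a.numOcc b = 0 then z ^ p.numOcc b else 0

section PatternWeight

variable {R : Type*} [CommSemiring R] (A : Set PermPattern) (p : PermPattern) (z : R)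

lemma patternWeight_congr {m : ℕ} {b c : Fin m → ℕ} (h : ∀ i j, b i < b j ↔ c i < c j) :
    patternWeight A p z b = patternWeight A p z c := by
  have numOcc_eq : ∀ q : PermPattern, q.numOcc b = q.numOcc c := fun q => q.numOcc_congr h
  classical
  exact if_congr (by simp only [numOcc_eq]) (by rw [numOcc_eq]) rfl

lemma patternWeight_fin_zero (b : Fin 0 → ℕ) : patternWeight A p z b = 1 := by
  simp only [patternWeight, PermPattern.numOcc_fin_zero, implies_true, if_true, pow_zero]

lemma sum_avoidingPerms_pow_occ (m : ℕ) :
    ∑ π ∈ avoidingPerms A m, z ^ p.occ π =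
      ∑ π : Equiv.Perm (Fin m), patternWeight A p z (fun i => (π i : ℕ)) := by
  rw [avoidingPerms, Finset.sum_filter]
  rfl

lemma sum_patternWeight_comp_perm {m : ℕ} {b : Fin m → ℕ} (hb : Function.Injective b) :
    ∑ ρ : Equiv.Perm (Fin m), patternWeight A p z (b ∘ ρ) =
      ∑ π ∈ avoidingPerms A m, z ^ p.occ π := by
  rw [sum_avoidingPerms_pow_occ]
  have sorted : StrictMono (b ∘ Tuple.sort b) :=
    (Tuple.monotone_sort b).strictMono_of_injective (hb.comp (Tuple.sort b).injective)
  refine Fintype.sum_equiv (Equiv.mulLeft (Tuple.sort b)⁻¹) _ _ fun ρ =>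
    patternWeight_congr A p z fun i j => ?_
  rw [Equiv.coe_mulLeft, Fin.val_fin_lt, ← sorted.lt_iff_lt]
  simp

lemma factorial_mul_sum_families_patternWeight {m : ℕ} {α β : Type*}
    (C : Finset α → Finset β) (S : Finset α) (root : β → ℕ)
    (hroot : ∀ g ∈ families (fun _ : Fin m => C) S, Function.Injective fun i => root (g i))
    (v : β → R) :
    (m.factorial : R) * ∑ g ∈ families (fun _ : Fin m => C) S,
        patternWeight A p z (fun i => root (g i)) * ∏ i, v (g i) =
      (∑ π ∈ avoidingPerms A m, z ^ p.occ π) *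
        ∑ g ∈ families (fun _ : Fin m => C) S, ∏ i, v (g i) := by
  set F := families (fun _ : Fin m => C) S
  calc (m.factorial : R) * ∑ g ∈ F, patternWeight A p z (fun i => root (g i)) * ∏ i, v (g i)
      = ∑ ρ : Equiv.Perm (Fin m), ∑ g ∈ F,
          patternWeight A p z (fun i => root ((g ∘ ρ) i)) * ∏ i, v ((g ∘ ρ) i) := by
        rw [Finset.sum_congr rfl fun ρ _ => sum_families_comp_perm C ρ fun g =>
            patternWeight A p z (fun i => root (g i)) * ∏ i, v (g i),
          Finset.sum_const, Finset.card_univ, Fintype.card_perm, Fintype.card_fin, nsmul_eq_mul]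
    _ = ∑ g ∈ F, (∑ ρ : Equiv.Perm (Fin m),
          patternWeight A p z ((fun i => root (g i)) ∘ ρ)) * ∏ i, v (g i) := by
        rw [Finset.sum_comm]
        refine Finset.sum_congr rfl fun g _ => ?_
        rw [Finset.sum_mul]
        refine Finset.sum_congr rfl fun ρ _ => ?_
        rw [← Equiv.prod_comp ρ fun i => v (g i)]
        rfl
    _ = (∑ π ∈ avoidingPerms A m, z ^ p.occ π) * ∑ g ∈ F, ∏ i, v (g i) := by
        rw [Finset.mul_sum]
        refine Finset.sum_congr rfl fun g hg => ?_
        rw [sum_patternWeight_comp_perm A p z (hroot g hg)]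

end PatternWeight

section PermEGF

variable {R : Type*} [CommRing R] [Algebra ℚ R] (A : Set PermPattern) (p : PermPattern) (z : R)

lemma egfCoeff_permEGF (n : ℕ) :
    egfCoeff (permEGF A p z) n = ∑ π ∈ avoidingPerms A n, z ^ p.occ π :=
  egfCoeff_mk_ite (c := fun n => ∑ π ∈ avoidingPerms A n, z ^ p.occ π)
    (by simp [sum_avoidingPerms_pow_occ, patternWeight_fin_zero]) n

lemma sum_families_patternWeight {m : ℕ} {α β : Type*} (C : Finset α → Finset β) (S : Finset α)
    (root : β → ℕ)
    (hroot : ∀ g ∈ families (fun _ : Fin m => C) S, Function.Injective fun i => root (g i))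
    (v : β → R) :
    ∑ g ∈ families (fun _ : Fin m => C) S,
        patternWeight A p z (fun i => root (g i)) * ∏ i, v (g i) =
      PowerSeries.coeff m (permEGF A p z) *
        ∑ g ∈ families (fun _ : Fin m => C) S, ∏ i, v (g i) := by
  refine (IsUnit.natCast_factorial_of_algebra ℚ m).mul_left_cancel ?_
  rw [factorial_mul_sum_families_patternWeight A p z C S root hroot, ← egfCoeff_permEGF, egfCoeff,
    mul_assoc]

end PermEGF

/-! ### Concatenations and segments -/

section Concatenation

variable {α : Type*} {m : ℕ}

/-- The concatenation of the words `τ 0, …, τ (m - 1)`. -/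
def concatFn (τ : Fin m → List α) : List α := (List.ofFn τ).flatten

/-- The concatenation of the first `n` of the words `τ`. -/
def prefixFn (τ : Fin m → List α) (n : ℕ) : List α := ((List.ofFn τ).take n).flatten

/-- The concatenation of all but the first `n` of the words `τ`. -/
def suffixFn (τ : Fin m → List α) (n : ℕ) : List α := ((List.ofFn τ).drop n).flatten

/-- No letter occurs in two of the words `τ`. -/
def LetterDisjoint {ι : Type*} (τ : ι → List α) : Prop :=
  ∀ ⦃a i j⦄, a ∈ τ i → a ∈ τ j → i = j

/-- `w` is a factor of `σ` that contains all occurrences in `σ` of its letters. -/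
def IsSegment (w σ : List α) : Prop := ∃ u v, σ = u ++ w ++ v ∧ ∀ a ∈ w, a ∉ u ∧ a ∉ v

lemma concatFn_zero (τ : Fin 0 → List α) : concatFn τ = [] := by
  rw [concatFn, List.ofFn_zero, List.flatten_nil]

lemma concatFn_succ (τ : Fin (m + 1) → List α) :
    concatFn τ = τ 0 ++ concatFn fun i => τ i.succ := by
  rw [concatFn, List.ofFn_succ, List.flatten_cons, concatFn]

lemma mem_concatFn {τ : Fin m → List α} {a : α} : a ∈ concatFn τ ↔ ∃ i, a ∈ τ i := by
  simp only [concatFn, List.mem_flatten, List.mem_ofFn, exists_exists_eq_and]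

lemma prefixFn_succ (τ : Fin m → List α) (i : Fin m) :
    prefixFn τ (i + 1) = prefixFn τ i ++ τ i := by
  simp [prefixFn, List.take_add_one, List.flatten_append]

lemma prefixFn_self (τ : Fin m → List α) : prefixFn τ m = concatFn τ := by
  rw [prefixFn, List.take_of_length_le (List.length_ofFn.le), concatFn]

lemma concatFn_eq_append (τ : Fin m → List α) (i : Fin m) :
    concatFn τ = prefixFn τ i ++ τ i ++ suffixFn τ (i + 1) := by
  rw [← prefixFn_succ, prefixFn, suffixFn, ← List.flatten_append, List.take_append_drop, concatFn]

lemma mem_prefixFn {τ : Fin m → List α} {n : ℕ} {a : α} :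
    a ∈ prefixFn τ n ↔ ∃ j : Fin m, (j : ℕ) < n ∧ a ∈ τ j := by
  simp only [prefixFn, List.mem_flatten, List.mem_take_iff_getElem, List.getElem_ofFn,
    List.length_ofFn, lt_min_iff]
  constructor
  · rintro ⟨_, ⟨i, hi, rfl⟩, ha⟩
    exact ⟨⟨i, hi.2⟩, hi.1, ha⟩
  · rintro ⟨j, hj, ha⟩
    exact ⟨_, ⟨j, ⟨hj, j.2⟩, rfl⟩, ha⟩

lemma mem_suffixFn {τ : Fin m → List α} {n : ℕ} {a : α} :
    a ∈ suffixFn τ n ↔ ∃ j : Fin m, n ≤ j ∧ a ∈ τ j := by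
  simp only [suffixFn, List.mem_flatten, List.mem_drop_iff_getElem, List.getElem_ofFn,
    List.length_ofFn]
  constructor
  · rintro ⟨_, ⟨i, hi, rfl⟩, ha⟩
    exact ⟨⟨n + i, by omega⟩, Nat.le_add_right _ _, ha⟩
  · rintro ⟨j, hj, ha⟩
    have hnj : n + (j - n : ℕ) = j := by omega
    refine ⟨τ j, ⟨j - n, by omega, ?_⟩, ha⟩
    congr 1
    exact Fin.ext hnj

namespace IsSegment

variable {u v w σ τ : List α}

lemma isInfix (h : IsSegment w σ) : w <:+: σ := by
  obtain ⟨u, v, h, -⟩ := h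
  exact ⟨u, v, h.symm⟩

lemma subset (h : IsSegment w σ) : w ⊆ σ := h.isInfix.subset

lemma trans (h : IsSegment w σ) (h' : IsSegment σ τ) : IsSegment w τ := by
  obtain ⟨u, v, rfl, h⟩ := h
  obtain ⟨u', v', rfl, h'⟩ := h'
  refine ⟨u' ++ u, v ++ v', by simp only [List.append_assoc], fun a ha => ?_⟩
  obtain ⟨hu', hv'⟩ := h' a (List.mem_append_left _ (List.mem_append_right _ ha))
  simp only [List.mem_append, not_or]
  exact ⟨⟨hu', (h a ha).1⟩, (h a ha).2, hv'⟩

lemma count_eq [DecidableEq α] (h : IsSegment w σ) {a : α} (ha : a ∈ w) :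
    σ.count a = w.count a := by
  obtain ⟨u, v, rfl, h⟩ := h
  rw [List.count_append, List.count_append, List.count_eq_zero_of_not_mem (h a ha).1,
    List.count_eq_zero_of_not_mem (h a ha).2, zero_add, add_zero]

lemma append_left (h : ∀ a ∈ w, a ∉ v) : IsSegment w (w ++ v) :=
  ⟨[], v, rfl, fun a ha => ⟨List.not_mem_nil, h a ha⟩⟩

lemma append_right (h : ∀ a ∈ u, a ∉ w) : IsSegment w (u ++ w) :=
  ⟨u, [], (List.append_nil _).symm, fun a ha => ⟨fun hu => h a hu ha, List.not_mem_nil⟩⟩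

end IsSegment

lemma LetterDisjoint.isSegment_concatFn {τ : Fin m → List α} (h : LetterDisjoint τ) (i : Fin m) :
    IsSegment (τ i) (concatFn τ) := by
  refine ⟨_, _, concatFn_eq_append τ i, fun a ha => ⟨fun h' => ?_, fun h' => ?_⟩⟩
  · obtain ⟨j, hj, haj⟩ := mem_prefixFn.1 h'
    obtain rfl := h ha haj
    exact lt_irrefl _ hj
  · obtain ⟨j, hj, haj⟩ := mem_suffixFn.1 h'
    obtain rfl := h ha haj
    exact absurd hj (Nat.not_succ_le_self _)

lemma cons_sublist_of_cons_sublist_append {x : α} {l u w : List α} (hu : x ∉ u)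
    (h : (x :: l).Sublist (u ++ w)) : (x :: l).Sublist w := by
  induction u with
  | nil => exact h
  | cons y u ih =>
    rw [List.mem_cons, not_or] at hu
    rw [List.cons_append, List.cons_sublist_cons'] at h
    exact h.elim (ih hu.2) fun h => absurd h.1 hu.1

lemma IsSegment.triple_sublist {w σ : List α} (h : IsSegment w σ) {x y : α} (hx : x ∈ w)
    (hs : [x, y, x].Sublist σ) : [x, y, x].Sublist w := by
  obtain ⟨u, v, rfl, h⟩ := h
  rw [List.append_assoc] at hs
  have hwv := (cons_sublist_of_cons_sublist_append (h x hx).1 hs).reverse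
  rw [List.reverse_append] at hwv
  exact List.reverse_sublist.1 (cons_sublist_of_cons_sublist_append
    (List.mem_reverse.not.2 (h x hx).2) hwv)

end Concatenation

/-! ### Stirling words -/

/-- `σ` has no subsequence `x y x` with `y < x`: it avoids the pattern 212. -/
def Avoids212 (σ : List ℕ) : Prop := ∀ ⦃x y⦄, [x, y, x].Sublist σ → x ≤ y

/-- `σ` is a `k`-Stirling permutation of the set of its letters. -/
structure IsKStirling (k : ℕ) (σ : List ℕ) : Prop where
  count_eq : ∀ a ∈ σ, σ.count a = k
  avoids212 : Avoids212 σ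

lemma triple_sublist_iff_getElem {α : Type*} {σ : List α} {x y z : α} :
    [x, y, z].Sublist σ ↔ ∃ a b c : Fin σ.length, a < b ∧ b < c ∧
      σ[a] = x ∧ σ[b] = y ∧ σ[c] = z := by
  rw [List.sublist_iff_exists_fin_orderEmbedding_get_eq]
  constructor
  · rintro ⟨f, hf⟩
    exact ⟨f 0, f 1, f 2, f.strictMono (by decide : (0 : Fin 3) < 1),
      f.strictMono (by decide : (1 : Fin 3) < 2), (hf 0).symm, (hf 1).symm, (hf 2).symm⟩
  · rintro ⟨a, b, c, hab, hbc, rfl, rfl, rfl⟩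
    have hmono : StrictMono (![a, b, c] : Fin 3 → Fin σ.length) :=
      Fin.strictMono_iff_lt_succ.2 (Fin.forall_fin_two.2 ⟨hab, hbc⟩)
    refine ⟨OrderEmbedding.ofStrictMono _ hmono, fun i : Fin 3 => ?_⟩
    fin_cases i <;> rfl

lemma exists_consecutive_occurrences {ι α : Type*} [LinearOrder ι] [Finite ι] {f : ι → α} {x : α}
    {a b c : ι} (hab : a < b) (hbc : b < c) (ha : f a = x) (hb : f b ≠ x) (hc : f c = x) :
    ∃ a' c', a' < b ∧ b < c' ∧ f a' = x ∧ f c' = x ∧ ∀ d, a' < d → d < c' → f d ≠ x := by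
  obtain ⟨a', ha'⟩ := (Set.toFinite {j | j < b ∧ f j = x}).exists_maximal ⟨a, hab, ha⟩
  obtain ⟨c', hc'⟩ := (Set.toFinite {j | b < j ∧ f j = x}).exists_minimal ⟨c, hbc, hc⟩
  refine ⟨a', c', ha'.prop.1, hc'.prop.1, ha'.prop.2, hc'.prop.2, fun d had hdc hd => ?_⟩
  rcases lt_trichotomy d b with hdb | rfl | hdb
  · exact ha'.not_prop_of_gt had ⟨hdb, hd⟩
  · exact hb hd
  · exact hc'.not_prop_of_lt hdc ⟨hdb, hd⟩

lemma isStirlingWord_iff_avoids212 {σ : List ℕ} : IsStirlingWord σ ↔ Avoids212 σ := by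
  constructor
  · intro h x y hs
    obtain ⟨a, b, c, hab, hbc, ha, rfl, hc⟩ := triple_sublist_iff_getElem.1 hs
    by_contra! hlt
    obtain ⟨a', c', hab', hbc', ha', hc', hd⟩ :=
      exists_consecutive_occurrences (f := fun j : Fin σ.length => σ[j]) hab hbc ha hlt.ne hc
    refine hlt.not_ge (ha' ▸ h a' c' (hab'.trans hbc') (ha'.trans hc'.symm) ?_ b hab' hbc').le
    exact fun d hd₁ hd₂ => ha'.symm ▸ hd d hd₁ hd₂
  · intro h a c _ hac hne b hab hbc
    exact lt_of_le_of_ne (h (triple_sublist_iff_getElem.2 ⟨a, b, c, hab, hbc, rfl, rfl, hac.symm⟩))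
      (hne b hab hbc).symm

lemma IsSegment.isKStirling {k : ℕ} {w σ : List ℕ} (h : IsSegment w σ) (hσ : IsKStirling k σ) :
    IsKStirling k w where
  count_eq a ha := h.count_eq ha ▸ hσ.count_eq a (h.subset ha)
  avoids212 _ _ hs := hσ.avoids212 (hs.trans h.isInfix.sublist)

lemma LetterDisjoint.isKStirling_concatFn {k m : ℕ} {τ : Fin m → List ℕ} (h : LetterDisjoint τ)
    (hτ : ∀ i, IsKStirling k (τ i)) : IsKStirling k (concatFn τ) where
  count_eq a ha := by
    obtain ⟨i, hi⟩ := mem_concatFn.1 ha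
    rw [(h.isSegment_concatFn i).count_eq hi, (hτ i).count_eq a hi]
  avoids212 x y hs := by
    obtain ⟨i, hi⟩ := mem_concatFn.1 (hs.subset (List.mem_cons_self (a := x)))
    exact (hτ i).avoids212 ((h.isSegment_concatFn i).triple_sublist hi hs)

open Classical in
/-- The `k`-Stirling permutations of `S`. -/
noncomputable def stirlingWords (k : ℕ) (S : Finset ℕ) : Finset (List ℕ) :=
  {σ ∈ (S.toList.flatMap (List.replicate k)).permutations.toFinset | Avoids212 σ}

lemma count_flatMap_replicate {α : Type*} [DecidableEq α] (k : ℕ) (a : α) {l : List α}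
    (hl : l.Nodup) : (l.flatMap (List.replicate k)).count a = if a ∈ l then k else 0 := by
  induction l with
  | nil => rfl
  | cons b l ih =>
    rw [List.nodup_cons] at hl
    rw [List.flatMap_cons, List.count_append, ih hl.2, List.count_replicate]
    by_cases hab : b = a
    · subst hab
      simp [hl.1]
    · simp [hab, Ne.symm hab]

lemma mem_stirlingWords {k : ℕ} (hk : 1 ≤ k) {S : Finset ℕ} {σ : List ℕ} :
    σ ∈ stirlingWords k S ↔ IsKStirling k σ ∧ σ.toFinset = S := by
  simp only [stirlingWords, Finset.mem_filter, List.mem_toFinset, List.mem_permutations,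
    List.perm_iff_count, count_flatMap_replicate _ _ S.nodup_toList, Finset.mem_toList]
  constructor
  · rintro ⟨hcount, h212⟩
    have hmem : ∀ a, a ∈ σ ↔ a ∈ S := fun a => by
      rw [← List.count_pos_iff, hcount]
      split_ifs with ha <;> simp only [ha, iff_true, iff_false] <;> omega
    refine ⟨⟨fun a ha => ?_, h212⟩, Finset.ext fun a => List.mem_toFinset.trans (hmem a)⟩
    rw [hcount, if_pos ((hmem a).1 ha)]
  · rintro ⟨hσ, rfl⟩
    refine ⟨fun a => ?_, hσ.avoids212⟩
    split_ifs with ha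
    · exact hσ.count_eq a (List.mem_toFinset.1 ha)
    · exact List.count_eq_zero_of_not_mem (List.mem_toFinset.not.1 ha)

lemma toFinset_eq_of_mem_stirlingWords {k : ℕ} (hk : 1 ≤ k) (S : Finset ℕ) :
    ∀ σ ∈ stirlingWords k S, σ.toFinset = S :=
  fun _ hσ => ((mem_stirlingWords hk).1 hσ).2

lemma kStirling_eq_stirlingWords (k n : ℕ) :
    kStirling k n = stirlingWords k (Finset.Icc 1 n) := by
  have hIcc : ((List.range n).map (· + 1)).Perm (Finset.Icc 1 n).toList := by
    rw [List.perm_ext_iff_of_nodup (List.nodup_range.map (add_left_injective 1))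
      (Finset.nodup_toList _)]
    intro a
    simp only [List.mem_map, List.mem_range, Finset.mem_toList, Finset.mem_Icc]
    exact ⟨by rintro ⟨b, hb, rfl⟩; omega, fun h => ⟨a - 1, by omega, by omega⟩⟩
  have hsorted : (sortedWord k n).Perm
      ((Finset.Icc 1 n).toList.flatMap (List.replicate k)) := by
    rw [sortedWord, ← List.flatMap_map (· + 1) (List.replicate k)]
    exact hIcc.flatMap_right _
  ext σ
  simp only [kStirling, stirlingWords, Finset.mem_filter, List.mem_toFinset,
    List.mem_permutations, isStirlingWord_iff_avoids212, hsorted.congr_right]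

/-! ### Forests of blocks -/

/-- A block `b w₁ b w₂ b ⋯ w_{k-1} b`, given by its letter `b` and by the gaps `w₁, …, w_{k-1}`
between the occurrences of `b`; the gap `w_s` of type `s` is `gap (s - 1)`. -/
@[ext]
structure RootedBlock (k : ℕ) where
  root : ℕ
  gap : Fin (k - 1) → List ℕ

namespace RootedBlock

variable {k : ℕ} (q : RootedBlock k)

/-- The word `b w₁ b w₂ b ⋯ w_{k-1} b`. -/
def word : List ℕ := q.root :: concatFn fun s => q.gap s ++ [q.root]

/-- The root of `q` and its gaps have no letters in common. -/
structure IsSeparated : Prop where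
  root_notMem : ∀ s, q.root ∉ q.gap s
  disjoint : LetterDisjoint q.gap

/-- The word of `q` is a `k`-Stirling word. -/
structure IsStirling : Prop where
  root_lt : ∀ s, ∀ a ∈ q.gap s, q.root < a
  disjoint : LetterDisjoint q.gap
  gap_isKStirling : ∀ s, IsKStirling k (q.gap s)

variable {q}

lemma IsStirling.isSeparated (hq : q.IsStirling) : q.IsSeparated where
  root_notMem s h := lt_irrefl _ (hq.root_lt s _ h)
  disjoint := hq.disjoint

lemma mem_word {a : ℕ} : a ∈ q.word ↔ a = q.root ∨ ∃ s, a ∈ q.gap s := by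
  simp only [word, List.mem_cons, mem_concatFn, List.mem_append, List.not_mem_nil, or_false]
  constructor
  · rintro (h | ⟨s, h | h⟩)
    exacts [.inl h, .inr ⟨s, h⟩, .inl h]
  · rintro (h | ⟨s, h⟩)
    exacts [.inl h, .inr ⟨s, .inl h⟩]

lemma root_mem_word : q.root ∈ q.word := mem_word.2 (.inl rfl)

lemma mem_word_of_mem_gap {s : Fin (k - 1)} {a : ℕ} (ha : a ∈ q.gap s) : a ∈ q.word :=
  mem_word.2 (.inr ⟨s, ha⟩)

lemma word_eq_append (q : RootedBlock k) (s : Fin (k - 1)) :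
    q.word = (q.root :: prefixFn (fun s => q.gap s ++ [q.root]) s) ++ q.gap s ++
      (q.root :: suffixFn (fun s => q.gap s ++ [q.root]) (s + 1)) := by
  rw [word, concatFn_eq_append _ s]
  simp only [List.append_assoc, List.cons_append, List.nil_append]

lemma IsSeparated.isSegment_gap (hq : q.IsSeparated) (s : Fin (k - 1)) :
    IsSegment (q.gap s) q.word := by
  refine ⟨_, _, q.word_eq_append s, fun a ha => ?_⟩
  have hne : a ≠ q.root := fun h => hq.root_notMem s (h ▸ ha)
  simp only [List.mem_cons, mem_prefixFn, mem_suffixFn, List.mem_append, List.not_mem_nil,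
    or_false, hne, false_or]
  constructor
  · rintro ⟨t, ht, hat⟩
    obtain rfl := hq.disjoint ha hat
    exact lt_irrefl _ ht
  · rintro ⟨t, ht, hat⟩
    obtain rfl := hq.disjoint ha hat
    exact absurd ht (Nat.not_succ_le_self _)

lemma count_root_prefixFn {m b n : ℕ} {w : Fin m → List ℕ} (hw : ∀ s, b ∉ w s) (hn : n ≤ m) :
    (prefixFn (fun s => w s ++ [b]) n).count b = n := by
  induction n with
  | zero => rw [prefixFn, List.take_zero, List.flatten_nil, List.count_nil]
  | succ n ih =>
    rw [prefixFn_succ _ (⟨n, hn⟩ : Fin m), List.count_append, List.count_append,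
      List.count_singleton_self, List.count_eq_zero_of_not_mem (hw _), zero_add, ih (by omega)]

lemma IsStirling.isKStirling_word (hk : 1 ≤ k) (hq : q.IsStirling) : IsKStirling k q.word where
  count_eq a ha := by
    rcases mem_word.1 ha with rfl | ⟨s, hs⟩
    · rw [word, List.count_cons_self, ← prefixFn_self,
        count_root_prefixFn hq.isSeparated.root_notMem le_rfl,
        Nat.sub_add_cancel hk]
    · rw [(hq.isSeparated.isSegment_gap s).count_eq hs, (hq.gap_isKStirling s).count_eq a hs]
  avoids212 x y h := by
    rcases mem_word.1 (h.subset (List.mem_cons_self (a := x))) with rfl | ⟨s, hs⟩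
    · rcases mem_word.1 (h.subset (List.mem_cons_of_mem _ (List.mem_cons_self (a := y)))) with
        rfl | ⟨s, hs⟩
      · exact le_rfl
      · exact (hq.root_lt s y hs).le
    · exact (hq.gap_isKStirling s).avoids212
        ((hq.isSeparated.isSegment_gap s).triple_sublist hs h)

end RootedBlock

/-- The concatenation of the words of the blocks `g`. -/
def forestWord {k m : ℕ} (g : Fin m → RootedBlock k) : List ℕ := concatFn fun i => (g i).word

/-- The roots and gaps of the blocks `g` have no letters in common. -/
structure IsForest {k m : ℕ} (g : Fin m → RootedBlock k) : Prop where
  isSeparated : ∀ i, (g i).IsSeparated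
  disjoint : LetterDisjoint fun i => (g i).word

/-- The blocks `g` are the level 1 blocks of a `k`-Stirling word. -/
structure IsStirlingForest {k m : ℕ} (g : Fin m → RootedBlock k) : Prop where
  isStirling : ∀ i, (g i).IsStirling
  disjoint : LetterDisjoint fun i => (g i).word

section Forest

variable {k m : ℕ} {g : Fin m → RootedBlock k}

lemma IsStirlingForest.isForest (hg : IsStirlingForest g) : IsForest g :=
  ⟨fun i => (hg.isStirling i).isSeparated, hg.disjoint⟩

lemma IsStirlingForest.isKStirling_forestWord (hk : 1 ≤ k) (hg : IsStirlingForest g) :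
    IsKStirling k (forestWord g) :=
  hg.disjoint.isKStirling_concatFn fun i => (hg.isStirling i).isKStirling_word hk

lemma mem_forestWord {a : ℕ} : a ∈ forestWord g ↔ ∃ i, a ∈ (g i).word := mem_concatFn

lemma forestWord_succ (g : Fin (m + 1) → RootedBlock k) :
    forestWord g = (g 0).word ++ forestWord fun i => g i.succ := concatFn_succ _

lemma forestWord_ne_nil (g : Fin (m + 1) → RootedBlock k) : forestWord g ≠ [] := by
  rw [forestWord_succ]
  exact List.cons_ne_nil _ _

lemma IsForest.isSegment_word (hg : IsForest g) (i : Fin m) :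
    IsSegment (g i).word (forestWord g) := hg.disjoint.isSegment_concatFn i

lemma IsForest.isSegment_gap (hg : IsForest g) (i : Fin m) (s : Fin (k - 1)) :
    IsSegment ((g i).gap s) (forestWord g) :=
  ((hg.isSeparated i).isSegment_gap s).trans (hg.isSegment_word i)

lemma IsForest.root_injective (hg : IsForest g) : Function.Injective fun i => (g i).root :=
  fun i j (h : (g i).root = (g j).root) =>
    hg.disjoint RootedBlock.root_mem_word (h ▸ RootedBlock.root_mem_word)

lemma IsForest.tail {g : Fin (m + 1) → RootedBlock k} (hg : IsForest g) :
    IsForest fun i => g i.succ where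
  isSeparated i := hg.isSeparated i.succ
  disjoint _ _ _ h h' := Fin.succ_injective _ (hg.disjoint h h')

lemma append_cons_inj_of_notMem_left {α : Type*} {b : α} {x y u v : List α}
    (hx : b ∉ x) (hy : b ∉ y) (h : x ++ b :: u = y ++ b :: v) : x = y ∧ u = v := by
  classical
  have hlen : x.length = y.length := by
    simpa [List.idxOf_append_of_notMem hx, List.idxOf_append_of_notMem hy]
      using congrArg (List.idxOf b) h
  obtain ⟨rfl, huv⟩ := List.append_inj h hlen
  exact ⟨rfl, List.cons_injective huv⟩

lemma concatFn_append_inj {α : Type*} {b : α} {w w' : Fin m → List α}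
    {u u' : List α} (hw : ∀ s, b ∉ w s) (hw' : ∀ s, b ∉ w' s)
    (h : concatFn (fun s => w s ++ [b]) ++ u = concatFn (fun s => w' s ++ [b]) ++ u') :
    w = w' ∧ u = u' := by
  induction m with
  | zero => exact ⟨Subsingleton.elim _ _, by simpa only [concatFn_zero, List.nil_append] using h⟩
  | succ m ih =>
    simp only [concatFn_succ, List.append_assoc, List.singleton_append] at h
    obtain ⟨h0, h⟩ := append_cons_inj_of_notMem_left (hw 0) (hw' 0) h
    obtain ⟨hs, hu⟩ := ih (fun s => hw s.succ) (fun s => hw' s.succ) h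
    exact ⟨funext (Fin.cases h0 fun s => congrFun hs s), hu⟩

lemma RootedBlock.word_append_inj {q q' : RootedBlock k} {u u' : List ℕ} (hq : q.IsSeparated)
    (hq' : q'.IsSeparated) (h : q.word ++ u = q'.word ++ u') : q = q' ∧ u = u' := by
  obtain ⟨hroot, h⟩ := List.cons_eq_cons.1 h
  rw [← hroot] at h
  obtain ⟨hgap, hu⟩ := concatFn_append_inj hq.root_notMem (hroot ▸ hq'.root_notMem) h
  exact ⟨RootedBlock.ext hroot hgap, hu⟩

lemma ofFn_eq_of_forestWord_eq {m' : ℕ} {g' : Fin m' → RootedBlock k} (hg : IsForest g)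
    (hg' : IsForest g') (h : forestWord g = forestWord g') : List.ofFn g = List.ofFn g' := by
  induction m generalizing m' with
  | zero =>
    cases m' with
    | zero => rw [List.ofFn_zero, List.ofFn_zero]
    | succ m' => exact absurd (h.symm.trans (concatFn_zero _)) (forestWord_ne_nil g')
  | succ m ih =>
    cases m' with
    | zero => exact absurd (h.trans (concatFn_zero _)) (forestWord_ne_nil g)
    | succ m' =>
      rw [forestWord_succ, forestWord_succ] at h
      obtain ⟨hhead, htail⟩ := RootedBlock.word_append_inj (hg.isSeparated 0) (hg'.isSeparated 0) h
      rw [List.ofFn_succ, List.ofFn_succ, hhead, ih hg.tail hg'.tail htail]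

end Forest

section Decomposition

variable {k : ℕ}

lemma exists_eq_concatFn_append {α : Type*} [DecidableEq α] (b : α) {n : ℕ} {l : List α}
    (h : l.count b = n) :
    ∃ (w : Fin n → List α) (u : List α), (∀ s, b ∉ w s) ∧ b ∉ u ∧
      l = concatFn (fun s => w s ++ [b]) ++ u := by
  induction n generalizing l with
  | zero =>
    refine ⟨Fin.elim0, l, fun s => s.elim0, List.count_eq_zero.1 h, ?_⟩
    rw [concatFn_zero, List.nil_append]
  | succ n ih =>
    have hb : b ∈ l := List.count_pos_iff.1 (by omega)
    obtain ⟨x, y, rfl, hx⟩ := List.eq_append_cons_of_mem hb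
    rw [List.count_append, List.count_cons_self, List.count_eq_zero_of_not_mem hx] at h
    obtain ⟨w, u, hw, hu, rfl⟩ := ih (l := y) (by omega)
    refine ⟨Fin.cons x w, u, Fin.cases hx hw, hu, ?_⟩
    simp only [concatFn_succ, Fin.cons_zero, Fin.cons_succ, List.append_assoc, List.cons_append,
      List.nil_append]

namespace RootedBlock

variable {q : RootedBlock k} {u : List ℕ}

lemma pair_sublist_word {s : Fin (k - 1)} {a : ℕ} (ha : a ∈ q.gap s) :
    [a, q.root].Sublist (concatFn fun s => q.gap s ++ [q.root]) := by
  rw [concatFn_eq_append _ s]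
  exact ((List.singleton_sublist.2 ha).append (List.Sublist.refl [q.root])).trans
    ((List.sublist_append_right _ _).trans (List.sublist_append_left _ _))

lemma triple_sublist_word {s t : Fin (k - 1)} (hst : s < t) {a : ℕ} (hs : a ∈ q.gap s)
    (ht : a ∈ q.gap t) : [a, q.root, a].Sublist q.word := by
  rw [word_eq_append q s, List.append_assoc]
  refine List.Sublist.trans ?_ (List.sublist_append_right _ _)
  have ha : a ∈ suffixFn (fun s => q.gap s ++ [q.root]) (s + 1) :=
    mem_suffixFn.2 ⟨t, hst, List.mem_append_left _ ht⟩
  exact (List.singleton_sublist.2 hs).append ((List.singleton_sublist.2 ha).cons_cons q.root)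

lemma root_lt_of_avoids212 (h212 : Avoids212 q.word) {s : Fin (k - 1)} {a : ℕ}
    (hroot : q.root ∉ q.gap s) (ha : a ∈ q.gap s) : q.root < a :=
  lt_of_le_of_ne (h212 ((pair_sublist_word ha).cons_cons q.root)) fun h => hroot (h ▸ ha)

lemma letterDisjoint_gap_of_avoids212 (h212 : Avoids212 q.word)
    (hroot : ∀ s, q.root ∉ q.gap s) : LetterDisjoint q.gap := by
  have gap_not_lt : ∀ {a s t}, a ∈ q.gap s → a ∈ q.gap t → ¬ s < t := fun hs ht hst =>
    (root_lt_of_avoids212 h212 (hroot _) hs).not_ge (h212 (triple_sublist_word hst hs ht))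
  exact fun a s t hs ht => le_antisymm (not_lt.1 (gap_not_lt ht hs)) (not_lt.1 (gap_not_lt hs ht))

lemma notMem_of_avoids212 (h212 : Avoids212 (q.word ++ u)) (hroot : ∀ s, q.root ∉ q.gap s)
    (hu : q.root ∉ u) : ∀ a ∈ q.word, a ∉ u := by
  intro a ha hau
  rcases mem_word.1 ha with rfl | ⟨s, hs⟩
  · exact hu hau
  have hword : Avoids212 q.word := fun x y h => h212 (h.trans (List.sublist_append_left _ _))
  have h : [a, q.root, a].Sublist (q.word ++ u) :=
    ((pair_sublist_word hs).cons q.root).append (List.singleton_sublist.2 hau)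
  exact (root_lt_of_avoids212 hword (hroot s) hs).not_ge (h212 h)

end RootedBlock

lemma IsKStirling.exists_eq_word_append {b : ℕ} {l : List ℕ} (h : IsKStirling k (b :: l)) :
    ∃ (q : RootedBlock k) (u : List ℕ), b :: l = q.word ++ u ∧ q.IsStirling ∧
      ∀ a ∈ q.word, a ∉ u := by
  have hcount : l.count b = k - 1 := by
    have := h.count_eq b List.mem_cons_self
    rw [List.count_cons_self] at this
    omega
  obtain ⟨w, u, hw, hu, rfl⟩ := exists_eq_concatFn_append b hcount
  let q : RootedBlock k := ⟨b, w⟩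
  change IsKStirling k (q.word ++ u) at h
  have hqu : ∀ a ∈ q.word, a ∉ u := RootedBlock.notMem_of_avoids212 h.avoids212 hw hu
  have hq : IsKStirling k q.word := (IsSegment.append_left hqu).isKStirling h
  have hdisj : LetterDisjoint q.gap :=
    RootedBlock.letterDisjoint_gap_of_avoids212 hq.avoids212 hw
  have hsep : q.IsSeparated := ⟨hw, hdisj⟩
  exact ⟨q, u, rfl, ⟨fun s a => RootedBlock.root_lt_of_avoids212 hq.avoids212 (hw s), hdisj,
    fun s => (hsep.isSegment_gap s).isKStirling hq⟩, hqu⟩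

lemma IsStirlingForest.cons {m : ℕ} {g : Fin m → RootedBlock k} {q : RootedBlock k}
    (hq : q.IsStirling) (hg : IsStirlingForest g) (hqg : ∀ a ∈ q.word, a ∉ forestWord g) :
    IsStirlingForest (Fin.cons q g : Fin (m + 1) → RootedBlock k) where
  isStirling := Fin.cases hq hg.isStirling
  disjoint a i j := by
    refine Fin.cases ?_ (fun i => ?_) i <;> refine Fin.cases ?_ (fun j => ?_) j
    · exact fun _ _ => rfl
    · exact fun h h' => absurd (mem_forestWord.2 ⟨j, h'⟩) (hqg a h)
    · exact fun h h' => absurd (mem_forestWord.2 ⟨i, h⟩) (hqg a h')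
    · exact fun h h' => congrArg Fin.succ (hg.disjoint h h')

lemma IsKStirling.exists_forestWord_eq {σ : List ℕ} (h : IsKStirling k σ) :
    ∃ (m : ℕ) (g : Fin m → RootedBlock k), IsStirlingForest g ∧ forestWord g = σ := by
  induction hn : σ.length using Nat.strong_induction_on generalizing σ with
  | _ n ih =>
  cases σ with
  | nil => exact ⟨0, Fin.elim0, ⟨fun i => i.elim0, fun _ i => i.elim0⟩, concatFn_zero _⟩
  | cons b l =>
    obtain ⟨q, u, hσ, hq, hqu⟩ := h.exists_eq_word_append
    rw [hσ] at h hn ⊢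
    have hlt : u.length < n := by
      rw [← hn, RootedBlock.word, List.length_append, List.length_cons]
      omega
    obtain ⟨m, g, hg, rfl⟩ := ih u.length hlt ((IsSegment.append_right hqu).isKStirling h) rfl
    exact ⟨m + 1, Fin.cons q g, hg.cons hq hqu, forestWord_succ _⟩

end Decomposition

/-! ### Blocks, levels, parents and types -/

section Block

variable {σ : List ℕ} {a c ℓ : ℕ}

lemma decide_ne_of_notMem {α : Type*} [DecidableEq α] {l : List α} {a : α} (h : a ∉ l) :
    ∀ x ∈ l, decide (x ≠ a) = true :=
  fun _ hx => decide_eq_true (ne_of_mem_of_not_mem hx h)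

lemma block_append_append {u t v : List ℕ} (hu : a ∉ u) (hv : a ∉ v)
    (hhead : t.head? = some a) (hlast : t.getLast? = some a) : block (u ++ t ++ v) a = t := by
  have hdrop : (u ++ t ++ v).dropWhile (· ≠ a) = t ++ v := by
    obtain ⟨t', rfl⟩ := List.head?_eq_some_iff.1 hhead
    rw [List.append_assoc, List.dropWhile_append_of_pos (decide_ne_of_notMem hu),
      List.cons_append, List.dropWhile_cons_of_neg (by simp)]
  rw [block, hdrop]
  obtain ⟨t', rfl⟩ := List.getLast?_eq_some_iff.1 hlast
  have hv' : a ∉ v.reverse := fun h => hv (List.mem_reverse.1 h)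
  rw [List.rdropWhile, List.reverse_append,
    List.dropWhile_append_of_pos (decide_ne_of_notMem hv'), List.reverse_append,
    List.reverse_singleton, List.singleton_append, List.dropWhile_cons_of_neg (by simp),
    List.reverse_cons, List.reverse_reverse]

lemma exists_eq_append_block_append (ha : a ∈ σ) :
    ∃ u v, σ = u ++ block σ a ++ v ∧ a ∉ u ∧ a ∉ v ∧ (block σ a).head? = some a ∧
      (block σ a).getLast? = some a := by
  obtain ⟨u, x, rfl, hu⟩ := List.eq_append_cons_of_mem ha
  obtain ⟨v, y, hy, hv⟩ := List.eq_append_cons_of_mem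
    (List.mem_reverse.2 (List.mem_cons_self (a := a) (l := x)))
  have hx : a :: x = (y.reverse ++ [a]) ++ v.reverse := by
    rw [← List.reverse_reverse (a :: x), hy, List.reverse_append, List.reverse_cons]
  have hhead : (y.reverse ++ [a]).head? = some a := by
    rw [← List.head?_append_of_ne_nil _ (List.append_ne_nil_of_right_ne_nil _
      (List.cons_ne_nil a [])), ← hx, List.head?_cons]
  have hlast : (y.reverse ++ [a]).getLast? = some a := List.getLast?_concat
  have hv' : a ∉ v.reverse := fun h => hv (List.mem_reverse.1 h)
  rw [hx, ← List.append_assoc, block_append_append hu hv' hhead hlast]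
  exact ⟨u, v.reverse, rfl, hu, hv', hhead, hlast⟩

lemma block_infix (ha : a ∈ σ) : block σ a <:+: σ := by
  obtain ⟨u, v, h, -⟩ := exists_eq_append_block_append ha
  exact ⟨u, v, h.symm⟩

lemma mem_block_self (ha : a ∈ σ) : a ∈ block σ a := by
  obtain ⟨-, -, -, -, -, h, -⟩ := exists_eq_append_block_append ha
  exact List.mem_of_head? h

lemma block_eq_nil (ha : a ∉ σ) : block σ a = [] := by
  rw [block, List.dropWhile_eq_nil_iff.2 (decide_ne_of_notMem ha), List.rdropWhile_nil]

lemma BlockSub.mem_block (h : BlockSub σ a c) : a ∈ block σ c :=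
  h.2.2.subset (mem_block_self h.1)

lemma BlockSub.right_mem (h : BlockSub σ a c) : c ∈ σ := by
  by_contra hc
  exact List.not_mem_nil (block_eq_nil hc ▸ h.mem_block)

lemma BlockSub.length_lt (h : BlockSub σ a c) : (block σ a).length < (block σ c).length := by
  refine lt_of_le_of_ne h.2.2.length_le fun hlen => h.2.1 ?_
  have heq := h.2.2.sublist.eq_of_length hlen
  obtain ⟨-, -, -, -, -, ha, -⟩ := exists_eq_append_block_append h.1
  obtain ⟨-, -, -, -, -, hc, -⟩ := exists_eq_append_block_append h.right_mem
  exact Option.some.inj (ha.symm.trans (heq ▸ hc))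

lemma IsLevel.mem (h : IsLevel σ ℓ a) : a ∈ σ := by
  match ℓ, h with
  | 1, h => exact h.1
  | _ + 2, ⟨_, _, _, h, _⟩ => exact h.1

lemma IsLevel.not_isLevelOne (h : IsLevel σ (ℓ + 2) a) : ¬ IsLevelOne σ a := by
  obtain ⟨j, hj, _, hs, _⟩ := h
  exact fun h1 => h1.2 j hj hs

lemma IsLevel.length_block_add_le {ℓ a : ℕ} (h : IsLevel σ ℓ a) :
    (block σ a).length + ℓ ≤ σ.length + 1 := by
  match ℓ, h with
  | 1, h => exact Nat.add_le_add_right (block_infix h.1).length_le 1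
  | ℓ + 2, ⟨j, _, hl, hs, _⟩ =>
    have := hl.length_block_add_le
    have := hs.length_lt
    omega

lemma IsLevel.le_length (h : IsLevel σ ℓ a) : ℓ ≤ σ.length := by
  have := h.length_block_add_le
  have := List.length_pos_of_mem (mem_block_self h.mem)
  omega

end Block

namespace IsSegment

variable {w σ : List ℕ} {a c : ℕ}

lemma block_eq (h : IsSegment w σ) (ha : a ∈ w) : block σ a = block w a := by
  obtain ⟨u, v, rfl, hw⟩ := h
  obtain ⟨u', v', h, hu, hv, hhead, hlast⟩ := exists_eq_append_block_append ha
  have huv : u ++ w ++ v = (u ++ u') ++ block w a ++ (v' ++ v) := by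
    conv_lhs => rw [h]
    simp only [List.append_assoc]
  rw [huv, block_append_append _ _ hhead hlast]
  · exact fun ha' => (List.mem_append.1 ha').elim (hw a ha).1 hu
  · exact fun ha' => (List.mem_append.1 ha').elim hv (hw a ha).2

lemma blockInterior_eq (h : IsSegment w σ) (ha : a ∈ w) :
    blockInterior σ a = blockInterior w a := by
  rw [blockInterior, h.block_eq ha, blockInterior]

lemma blockSub_iff (h : IsSegment w σ) (hc : c ∈ w) : BlockSub σ a c ↔ BlockSub w a c := by
  constructor
  · intro hs
    have ha : a ∈ w := (block_infix hc).subset (h.block_eq hc ▸ hs.mem_block)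
    exact ⟨ha, hs.2.1, h.block_eq hc ▸ h.block_eq ha ▸ hs.2.2⟩
  · intro hs
    refine ⟨h.subset hs.1, hs.2.1, ?_⟩
    rw [h.block_eq hc, h.block_eq hs.1]
    exact hs.2.2

lemma count_takeWhile (h : IsSegment w σ) (ha : a ∈ w) (hc : c ∈ w) :
    (σ.takeWhile (· ≠ a)).count c = (w.takeWhile (· ≠ a)).count c := by
  obtain ⟨u, v, rfl, hw⟩ := h
  obtain ⟨x, y, rfl, hx⟩ := List.eq_append_cons_of_mem ha
  have hx' := decide_ne_of_notMem hx
  rw [List.append_assoc, List.append_assoc,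
    List.takeWhile_append_of_pos (decide_ne_of_notMem (hw a ha).1),
    List.takeWhile_append_of_pos hx', List.takeWhile_append_of_pos hx', List.count_append,
    List.count_eq_zero_of_not_mem (hw c hc).1, zero_add, List.cons_append,
    List.takeWhile_cons_of_neg (by simp), List.takeWhile_cons_of_neg (by simp)]

lemma exists_idxOf_eq_add (h : IsSegment w σ) : ∃ N, ∀ a ∈ w, σ.idxOf a = N + w.idxOf a := by
  obtain ⟨u, v, rfl, hw⟩ := h
  refine ⟨u.length, fun a ha => ?_⟩
  rw [List.append_assoc, List.idxOf_append_of_notMem (hw a ha).1, List.idxOf_append_of_mem ha]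

lemma isBlockOcc_iff (h : IsSegment w σ) {sib sib' : ℕ → ℕ → Prop} {p : PermPattern}
    {b : Fin p.len → ℕ} (hb : ∀ a, b a ∈ w) (hs : ∀ a c, sib (b a) (b c) ↔ sib' (b a) (b c)) :
    IsBlockOcc sib σ p b ↔ IsBlockOcc sib' w p b := by
  obtain ⟨N, hN⟩ := h.exists_idxOf_eq_add
  simp only [IsBlockOcc, StrictMono, hs, hN _ (hb _), h.block_eq (hb _), add_assoc,
    add_right_inj, add_lt_add_iff_left, hb, h.subset (hb _)]

end IsSegment

lemma LetterDisjoint.isLevelOne_concatFn {m : ℕ} {τ : Fin m → List ℕ} (h : LetterDisjoint τ)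
    {a : ℕ} : IsLevelOne (concatFn τ) a ↔ ∃ i, IsLevelOne (τ i) a := by
  have hseg := h.isSegment_concatFn
  constructor
  · rintro ⟨ha, hsub⟩
    obtain ⟨i, hi⟩ := mem_concatFn.1 ha
    exact ⟨i, hi, fun j hj hs => hsub j ((hseg i).subset hj) (((hseg i).blockSub_iff hj).2 hs)⟩
  · rintro ⟨i, ha, hsub⟩
    refine ⟨(hseg i).subset ha, fun j hj hs => ?_⟩
    obtain ⟨i', hi'⟩ := mem_concatFn.1 hj
    have hs := ((hseg i').blockSub_iff hi').1 hs
    obtain rfl := h ha hs.1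
    exact hsub j hi' hs

namespace RootedBlock

variable {k : ℕ} (q : RootedBlock k)

lemma getLast?_word : q.word.getLast? = some q.root := by
  have hlast (m : ℕ) (w : Fin m → List ℕ) :
      (q.root :: concatFn fun s => w s ++ [q.root]).getLast? = some q.root := by
    cases m with
    | zero => rw [concatFn_zero, List.getLast?_singleton]
    | succ m =>
      rw [concatFn, List.ofFn_succ', List.concat_eq_append, List.flatten_append,
        List.flatten_singleton, ← List.append_assoc, ← List.cons_append, List.getLast?_concat]
  exact hlast _ _

lemma block_word_root : block q.word q.root = q.word := by
  have h := block_append_append (u := []) (t := q.word) (v := []) List.not_mem_nil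
    List.not_mem_nil rfl q.getLast?_word
  rwa [List.nil_append, List.append_nil] at h

variable {q}

lemma IsSeparated.blockInterior_word_root (hq : q.IsSeparated) :
    blockInterior q.word q.root = concatFn q.gap := by
  have hgap (s) : (q.gap s ++ [q.root]).filter (· ≠ q.root) = q.gap s := by
    rw [List.filter_append, List.filter_eq_self.2 (decide_ne_of_notMem (hq.root_notMem s)),
      List.filter_eq_nil_iff.2 (by simp), List.append_nil]
  rw [blockInterior, block_word_root, word, List.filter_cons_of_neg (by simp), concatFn,
    List.filter_flatten, List.map_ofFn, concatFn]
  exact congrArg (fun w => (List.ofFn w).flatten) (funext hgap)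

lemma IsSeparated.count_root_takeWhile (hq : q.IsSeparated) {a : ℕ} {s : Fin (k - 1)}
    (ha : a ∈ q.gap s) : (q.word.takeWhile (· ≠ a)).count q.root = s + 1 := by
  obtain ⟨x, y, hxy, hx⟩ := List.eq_append_cons_of_mem ha
  have hroot : q.root ∉ x := fun h => hq.root_notMem s (by
    rw [hxy]
    exact List.mem_append_left _ h)
  have hprefix : a ∉ q.root :: prefixFn (fun s => q.gap s ++ [q.root]) s := by
    have hne : a ≠ q.root := fun h => hq.root_notMem s (h ▸ ha)
    simp only [List.mem_cons, mem_prefixFn, List.mem_append, List.not_mem_nil, or_false, hne,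
      false_or, not_exists, not_and]
    intro t ht hat
    obtain rfl := hq.disjoint ha hat
    exact lt_irrefl _ ht
  rw [word_eq_append q s, hxy, List.append_assoc,
    List.takeWhile_append_of_pos (decide_ne_of_notMem hprefix), List.append_assoc,
    List.takeWhile_append_of_pos (decide_ne_of_notMem hx), List.cons_append,
    List.cons_append, List.takeWhile_cons_of_neg (by simp), List.append_nil,
    List.count_cons_self, List.count_append, List.count_eq_zero_of_not_mem hroot, add_zero,
    count_root_prefixFn hq.root_notMem s.2.le]

end RootedBlock

namespace IsForest

variable {m k : ℕ} {g : Fin m → RootedBlock k}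

lemma block_root (hg : IsForest g) (i : Fin m) :
    block (forestWord g) (g i).root = (g i).word := by
  rw [(hg.isSegment_word i).block_eq RootedBlock.root_mem_word, RootedBlock.block_word_root]

lemma blockInterior_root (hg : IsForest g) (i : Fin m) :
    blockInterior (forestWord g) (g i).root = concatFn (g i).gap := by
  rw [(hg.isSegment_word i).blockInterior_eq RootedBlock.root_mem_word,
    (hg.isSeparated i).blockInterior_word_root]

lemma root_mem_forestWord (g : Fin m → RootedBlock k) (i : Fin m) :
    (g i).root ∈ forestWord g := mem_forestWord.2 ⟨i, RootedBlock.root_mem_word⟩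

lemma root_notMem_gap (hg : IsForest g) (i j : Fin m) (s : Fin (k - 1)) :
    (g i).root ∉ (g j).gap s := fun h => by
  obtain rfl := hg.disjoint RootedBlock.root_mem_word (RootedBlock.mem_word_of_mem_gap h)
  exact (hg.isSeparated i).root_notMem s h

lemma gap_inj (hg : IsForest g) {a : ℕ} {i j : Fin m} {s t : Fin (k - 1)}
    (hi : a ∈ (g i).gap s) (hj : a ∈ (g j).gap t) : i = j ∧ s = t := by
  obtain rfl := hg.disjoint (RootedBlock.mem_word_of_mem_gap hi)
    (RootedBlock.mem_word_of_mem_gap hj)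
  exact ⟨rfl, (hg.isSeparated i).disjoint hi hj⟩

lemma blockSub_root (hg : IsForest g) {i : Fin m} {a : ℕ} :
    BlockSub (forestWord g) a (g i).root ↔ ∃ s, a ∈ (g i).gap s := by
  constructor
  · intro h
    exact (RootedBlock.mem_word.1 (hg.block_root i ▸ h.mem_block)).resolve_left h.2.1
  · rintro ⟨s, hs⟩
    refine ⟨(hg.isSegment_gap i s).subset hs, fun h => hg.root_notMem_gap i i s (h ▸ hs), ?_⟩
    rw [(hg.isSegment_gap i s).block_eq hs, hg.block_root]
    exact (block_infix hs).trans ((hg.isSeparated i).isSegment_gap s).isInfix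

lemma isLevel_one (hg : IsForest g) {a : ℕ} :
    IsLevel (forestWord g) 1 a ↔ ∃ i, a = (g i).root := by
  constructor
  · rintro ⟨ha, hsub⟩
    obtain ⟨i, hi⟩ := mem_forestWord.1 ha
    exact ⟨i, (RootedBlock.mem_word.1 hi).resolve_right fun hgap =>
      hsub _ (root_mem_forestWord g i) (hg.blockSub_root.2 hgap)⟩
  · rintro ⟨i, rfl⟩
    refine ⟨root_mem_forestWord g i, fun j hj hs => ?_⟩
    obtain ⟨i', hi'⟩ := mem_forestWord.1 hj
    obtain rfl | ⟨s, hs'⟩ := RootedBlock.mem_word.1 hi'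
    · obtain ⟨s, hs⟩ := hg.blockSub_root.1 hs
      exact hg.root_notMem_gap _ _ _ hs
    · exact hg.root_notMem_gap _ _ _ (((hg.isSegment_gap i' s).blockSub_iff hs').1 hs).1

lemma isLevel_two (hg : IsForest g) {a : ℕ} :
    IsLevel (forestWord g) 2 a ↔ ∃ i s, IsLevel ((g i).gap s) 1 a := by
  have hinterior (i) : IsLevelOne (blockInterior (forestWord g) (g i).root) a ↔
      ∃ s, IsLevelOne ((g i).gap s) a := by
    rw [hg.blockInterior_root, (hg.isSeparated i).disjoint.isLevelOne_concatFn]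
  constructor
  · rintro ⟨j, -, hj, hs, h⟩
    obtain ⟨i, rfl⟩ := hg.isLevel_one.1 hj
    exact ⟨i, (hinterior i).1 h⟩
  · rintro ⟨i, s, h⟩
    exact ⟨(g i).root, root_mem_forestWord g i, hg.isLevel_one.2 ⟨i, rfl⟩,
      hg.blockSub_root.2 ⟨s, h.mem⟩, (hinterior i).2 ⟨s, h⟩⟩

lemma isLevel_add_two (hg : IsForest g) {ℓ a : ℕ} :
    IsLevel (forestWord g) (ℓ + 2) a ↔ ∃ i s, IsLevel ((g i).gap s) (ℓ + 1) a := by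
  induction ℓ generalizing a with
  | zero => exact hg.isLevel_two
  | succ ℓ ih =>
    constructor
    · rintro ⟨j, -, hj, hs, h⟩
      obtain ⟨i, s, hj⟩ := ih.1 hj
      have hseg := hg.isSegment_gap i s
      exact ⟨i, s, j, hj.mem, hj, (hseg.blockSub_iff hj.mem).1 hs,
        hseg.blockInterior_eq hj.mem ▸ h⟩
    · rintro ⟨i, s, j, hjm, hj, hs, h⟩
      have hseg := hg.isSegment_gap i s
      rw [← hseg.blockInterior_eq hjm] at h
      exact ⟨j, hseg.subset hjm, ih.2 ⟨i, s, hj⟩, (hseg.blockSub_iff hjm).2 hs, h⟩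

lemma isLevel_iff_of_mem_gap (hg : IsForest g) {ℓ a : ℕ} {i : Fin m} {s : Fin (k - 1)}
    (ha : a ∈ (g i).gap s) :
    IsLevel (forestWord g) (ℓ + 1) a ↔ IsLevel ((g i).gap s) ℓ a := by
  cases ℓ with
  | zero =>
    rw [hg.isLevel_one]
    simp only [IsLevel, iff_false, not_exists]
    rintro j rfl
    exact hg.root_notMem_gap _ _ _ ha
  | succ ℓ =>
    rw [hg.isLevel_add_two]
    refine ⟨fun ⟨j, t, h⟩ => ?_, fun h => ⟨i, s, h⟩⟩
    obtain ⟨rfl, rfl⟩ := hg.gap_inj ha h.mem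
    exact h

lemma isParent_root (hg : IsForest g) {a : ℕ} {i : Fin m} :
    IsParent (forestWord g) (g i).root a ↔ ∃ s, IsLevel ((g i).gap s) 1 a := by
  constructor
  · rintro ⟨hs, ℓ, hroot, ha⟩
    obtain ⟨s, hs⟩ := hg.blockSub_root.1 hs
    rw [hg.isLevel_iff_of_mem_gap hs] at ha
    match ℓ, hroot with
    | 1, _ => exact ⟨s, ha⟩
    | ℓ + 2, hroot =>
      obtain ⟨j, t, h⟩ := hg.isLevel_add_two.1 hroot
      exact absurd h.mem (hg.root_notMem_gap _ _ _)
  · rintro ⟨s, h⟩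
    exact ⟨hg.blockSub_root.2 ⟨s, h.mem⟩, 1, hg.isLevel_one.2 ⟨i, rfl⟩,
      (hg.isLevel_iff_of_mem_gap h.mem).2 h⟩

lemma isParent_iff_of_mem_gap (hg : IsForest g) {a h : ℕ} {i : Fin m} {s : Fin (k - 1)}
    (hh : h ∈ (g i).gap s) : IsParent (forestWord g) h a ↔ IsParent ((g i).gap s) h a := by
  rw [IsParent, (hg.isSegment_gap i s).blockSub_iff hh, IsParent]
  refine and_congr_right fun hs => ?_
  constructor
  · rintro ⟨ℓ, hlevel, ha⟩
    match ℓ, hlevel, ha with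
    | ℓ + 1, hlevel, ha =>
      exact ⟨ℓ, (hg.isLevel_iff_of_mem_gap hh).1 hlevel, (hg.isLevel_iff_of_mem_gap hs.1).1 ha⟩
  · rintro ⟨ℓ, hlevel, ha⟩
    exact ⟨ℓ + 1, (hg.isLevel_iff_of_mem_gap hh).2 hlevel, (hg.isLevel_iff_of_mem_gap hs.1).2 ha⟩

lemma isParent_cases (hg : IsForest g) {a h : ℕ} {i : Fin m} {s : Fin (k - 1)}
    (ha : a ∈ (g i).gap s) (hp : IsParent (forestWord g) h a) :
    (h = (g i).root ∧ IsLevel ((g i).gap s) 1 a) ∨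
      (h ∈ (g i).gap s ∧ IsParent ((g i).gap s) h a ∧ ¬ IsLevelOne ((g i).gap s) a) := by
  obtain ⟨j, hj⟩ := mem_forestWord.1 hp.1.right_mem
  obtain rfl | ⟨t, ht⟩ := RootedBlock.mem_word.1 hj
  · obtain ⟨t, h⟩ := hg.isParent_root.1 hp
    obtain ⟨rfl, rfl⟩ := hg.gap_inj ha h.mem
    exact .inl ⟨rfl, h⟩
  · have hp := (hg.isParent_iff_of_mem_gap ht).1 hp
    obtain ⟨rfl, rfl⟩ := hg.gap_inj ha hp.1.1
    exact .inr ⟨ht, hp, fun h => h.2 _ ht hp.1⟩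

lemma count_root_takeWhile (hg : IsForest g) {a : ℕ} {i : Fin m} {s : Fin (k - 1)}
    (ha : a ∈ (g i).gap s) :
    ((forestWord g).takeWhile (· ≠ a)).count (g i).root = s + 1 := by
  rw [(hg.isSegment_word i).count_takeWhile (RootedBlock.mem_word_of_mem_gap ha)
    RootedBlock.root_mem_word, (hg.isSeparated i).count_root_takeWhile ha]

lemma hasType_iff_of_isLevel_one (hg : IsForest g) {a t : ℕ} {i : Fin m} {s : Fin (k - 1)}
    (ha : IsLevel ((g i).gap s) 1 a) : HasType (forestWord g) a t ↔ t = s + 1 := by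
  constructor
  · rintro ⟨h, hp, rfl⟩
    rcases hg.isParent_cases ha.mem hp with ⟨rfl, -⟩ | ⟨-, -, h⟩
    · exact hg.count_root_takeWhile ha.mem
    · exact absurd ha h
  · rintro rfl
    exact ⟨(g i).root, hg.isParent_root.2 ⟨s, ha⟩, hg.count_root_takeWhile ha.mem⟩

lemma hasType_iff_of_not_isLevelOne (hg : IsForest g) {a t : ℕ} {i : Fin m} {s : Fin (k - 1)}
    (hm : a ∈ (g i).gap s) (ha : ¬ IsLevelOne ((g i).gap s) a) :
    HasType (forestWord g) a t ↔ HasType ((g i).gap s) a t := by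
  constructor
  · rintro ⟨h, hp, rfl⟩
    rcases hg.isParent_cases hm hp with ⟨rfl, h⟩ | ⟨hh, hp, -⟩
    · exact absurd h ha
    · exact ⟨h, hp, ((hg.isSegment_gap i s).count_takeWhile hm hh).symm⟩
  · rintro ⟨h, hp, rfl⟩
    have hh := hp.1.right_mem
    exact ⟨h, (hg.isParent_iff_of_mem_gap hh).2 hp, (hg.isSegment_gap i s).count_takeWhile hm hh⟩

lemma isLevel_two_and_hasType (hg : IsForest g) {a : ℕ} {s : Fin (k - 1)} :
    IsLevel (forestWord g) 2 a ∧ HasType (forestWord g) a (s + 1) ↔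
      ∃ i, IsLevel ((g i).gap s) 1 a := by
  constructor
  · rintro ⟨h, ht⟩
    obtain ⟨i, s', h⟩ := hg.isLevel_two.1 h
    rw [hg.hasType_iff_of_isLevel_one h, Nat.add_right_cancel_iff, Fin.val_inj] at ht
    exact ⟨i, ht ▸ h⟩
  · rintro ⟨i, h⟩
    exact ⟨hg.isLevel_two.2 ⟨i, s, h⟩, (hg.hasType_iff_of_isLevel_one h).2 rfl⟩

lemma isLevel_add_three_and_hasType (hg : IsForest g) {ℓ a t : ℕ} :
    IsLevel (forestWord g) (ℓ + 3) a ∧ HasType (forestWord g) a t ↔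
      ∃ i s, IsLevel ((g i).gap s) (ℓ + 2) a ∧ HasType ((g i).gap s) a t := by
  constructor
  · rintro ⟨h, ht⟩
    obtain ⟨i, s, h⟩ := hg.isLevel_add_two.1 h
    rw [hg.hasType_iff_of_not_isLevelOne h.mem h.not_isLevelOne] at ht
    exact ⟨i, s, h, ht⟩
  · rintro ⟨i, s, h, ht⟩
    exact ⟨hg.isLevel_add_two.2 ⟨i, s, h⟩,
      (hg.hasType_iff_of_not_isLevelOne h.mem h.not_isLevelOne).2 ht⟩

end IsForest

/-! ### Block statistics of a forest -/

lemma ncard_iUnion_eq_sum {ι α : Type*} [Fintype ι] {U : ι → Set α} (hfin : ∀ i, (U i).Finite)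
    (hdisj : ∀ x i j, x ∈ U i → x ∈ U j → i = j) : (⋃ i, U i).ncard = ∑ i, (U i).ncard := by
  rw [Set.ncard_iUnion_of_finite hfin, finsum_eq_sum_of_fintype]
  intro i j hij
  exact Set.disjoint_left.2 fun x hi hj => hij (hdisj x i j hi hj)

lemma finite_isBlockOcc (sib : ℕ → ℕ → Prop) (σ : List ℕ) (p : PermPattern) :
    {b | IsBlockOcc sib σ p b}.Finite := by
  refine (Set.Finite.pi' (t := fun _ : Fin p.len => {a | a ∈ σ}) fun _ => ?_).subset
    fun b hb => hb.2.1
  exact List.finite_toSet σ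

lemma ncard_isBlockOcc_eq_sum {ι : Type*} [Fintype ι] {σ : List ℕ} {w : ι → List ℕ}
    (hw : ∀ i, IsSegment (w i) σ) (hdisj : LetterDisjoint w)
    {P : ℕ → Prop} {P' : ι → ℕ → Prop} (hP : ∀ a, P a ↔ ∃ i, P' i a)
    (hmem : ∀ i a, P' i a → a ∈ w i)
    {sib : ℕ → ℕ → Prop} {sib' : ι → ℕ → ℕ → Prop}
    (hsib : ∀ i j a c, P' i a → P' j c → (sib a c ↔ i = j ∧ sib' i a c)) (p : PermPattern) :
    {b : Fin p.len → ℕ | IsBlockOcc sib σ p b ∧ ∀ a, P (b a)}.ncard =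
      ∑ i, {b : Fin p.len → ℕ | IsBlockOcc (sib' i) (w i) p b ∧ ∀ a, P' i (b a)}.ncard := by
  have isBlockOcc_iff {i : ι} {b : Fin p.len → ℕ} (hb : ∀ a, P' i (b a)) :
      IsBlockOcc sib σ p b ↔ IsBlockOcc (sib' i) (w i) p b :=
    (hw i).isBlockOcc_iff (fun a => hmem _ _ (hb a)) fun a c => by
      rw [hsib i i _ _ (hb a) (hb c), eq_self_iff_true, true_and]
  rw [← ncard_iUnion_eq_sum]
  · congr 1
    ext b
    simp only [Set.mem_ofPred_eq, Set.mem_iUnion]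
    constructor
    · rintro ⟨hb, hbP⟩
      obtain ⟨i, hi⟩ := (hP _).1 (hbP ⟨0, hb.1⟩)
      have hbi (a) : P' i (b a) := by
        obtain ⟨j, hj⟩ := (hP _).1 (hbP a)
        obtain ⟨rfl, -⟩ := (hsib i j _ _ hi hj).1 (hb.2.2.1 _ _)
        exact hj
      exact ⟨i, (isBlockOcc_iff hbi).1 hb, hbi⟩
    · rintro ⟨i, hb, hbi⟩
      exact ⟨(isBlockOcc_iff hbi).2 hb, fun a => (hP _).2 ⟨i, hbi a⟩⟩
  · exact fun i => (finite_isBlockOcc _ _ p).subset fun b hb => hb.1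
  · exact fun b i j hi hj => hdisj (hmem _ _ (hi.2 ⟨0, hi.1.1⟩)) (hmem _ _ (hj.2 ⟨0, hi.1.1⟩))

lemma strictMono_length_prefixFn {α : Type*} {m : ℕ} {τ : Fin m → List α} (hτ : ∀ i, τ i ≠ []) :
    StrictMono fun n : Fin (m + 1) => (prefixFn τ n).length := by
  refine Fin.strictMono_iff_lt_succ.2 fun i => ?_
  rw [Fin.val_castSucc, Fin.val_succ, prefixFn_succ, List.length_append]
  exact Nat.lt_add_of_pos_right (List.length_pos_iff.2 (hτ i))

namespace IsForest

variable {m k : ℕ} {g : Fin m → RootedBlock k}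

lemma numBlocks_one (hg : IsForest g) : numBlocks (forestWord g) 1 = m := by
  have hrange : {a | IsLevel (forestWord g) 1 a} = Set.range fun i => (g i).root := by
    ext a
    simp only [hg.isLevel_one, Set.mem_ofPred_eq, Set.mem_range, eq_comm]
  rw [numBlocks, hrange, Set.ncard_range_of_injective hg.root_injective, Nat.card_fin]

lemma numBlocksOfType_two (hg : IsForest g) (s : Fin (k - 1)) :
    numBlocksOfType (forestWord g) 2 (s + 1) = ∑ i, numBlocks ((g i).gap s) 1 := by
  simp only [numBlocksOfType, hg.isLevel_two_and_hasType, numBlocks]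
  rw [Set.ofPred_exists, ncard_iUnion_eq_sum]
  · exact fun i => (List.finite_toSet ((g i).gap s)).subset fun a ha => IsLevel.mem ha
  · exact fun a i j hi hj => (hg.gap_inj hi.mem hj.mem).1

lemma letterDisjoint_gap (hg : IsForest g) :
    LetterDisjoint fun q : Fin m × Fin (k - 1) => (g q.1).gap q.2 :=
  fun _ _ _ hi hj => Prod.ext_iff.2 (hg.gap_inj hi hj)

lemma numBlocksOfType_add_three (hg : IsForest g) (ℓ t : ℕ) :
    numBlocksOfType (forestWord g) (ℓ + 3) t =
      ∑ i, ∑ s, numBlocksOfType ((g i).gap s) (ℓ + 2) t := by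
  simp only [numBlocksOfType, hg.isLevel_add_three_and_hasType]
  rw [← Fintype.sum_prod_type', ← ncard_iUnion_eq_sum]
  · congr 1
    ext a
    simp only [Set.mem_ofPred_eq, Set.mem_iUnion, Prod.exists]
  · exact fun q => (List.finite_toSet ((g q.1).gap q.2)).subset fun a ha => IsLevel.mem ha.1
  · exact fun a q q' hq hq' => hg.letterDisjoint_gap hq.1.mem hq'.1.mem

lemma kSibling_iff_of_isLevel_one (hg : IsForest g) {a c : ℕ} {i j : Fin m} {s : Fin (k - 1)}
    (ha : IsLevel ((g i).gap s) 1 a) (hc : IsLevel ((g j).gap s) 1 c) :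
    KSibling (forestWord g) a c ↔ i = j ∧ KSibling ((g i).gap s) a c := by
  constructor
  · rintro (⟨h, -⟩ | ⟨⟨h, hpa, hpc⟩, -⟩)
    · exact absurd h (hg.isLevel_two.2 ⟨i, s, ha⟩).not_isLevelOne
    · rcases hg.isParent_cases ha.mem hpa with ⟨rfl, -⟩ | ⟨-, -, h⟩
      · obtain ⟨t, ht⟩ := hg.isParent_root.1 hpc
        obtain ⟨rfl, rfl⟩ := hg.gap_inj hc.mem ht.mem
        exact ⟨rfl, .inl ⟨ha, hc⟩⟩
      · exact absurd ha h
  · rintro ⟨rfl, -⟩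
    exact .inr ⟨⟨(g i).root, hg.isParent_root.2 ⟨s, ha⟩, hg.isParent_root.2 ⟨s, hc⟩⟩, s + 1,
      (hg.hasType_iff_of_isLevel_one ha).2 rfl, (hg.hasType_iff_of_isLevel_one hc).2 rfl⟩

lemma kSibling_iff_of_isLevel_add_two (hg : IsForest g) {ℓ a c : ℕ} {q q' : Fin m × Fin (k - 1)}
    (ha : IsLevel ((g q.1).gap q.2) (ℓ + 2) a) (hc : IsLevel ((g q'.1).gap q'.2) (ℓ + 2) c) :
    KSibling (forestWord g) a c ↔ q = q' ∧ KSibling ((g q.1).gap q.2) a c := by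
  have hasType_a (t) := hg.hasType_iff_of_not_isLevelOne (t := t) ha.mem ha.not_isLevelOne
  have hasType_c (t) := hg.hasType_iff_of_not_isLevelOne (t := t) hc.mem hc.not_isLevelOne
  constructor
  · rintro (⟨h, -⟩ | ⟨⟨h, hpa, hpc⟩, t, hta, htc⟩)
    · exact absurd h (hg.isLevel_add_two.2 ⟨_, _, ha⟩).not_isLevelOne
    · rcases hg.isParent_cases ha.mem hpa with ⟨-, h⟩ | ⟨hh, hpa, -⟩
      · exact absurd h ha.not_isLevelOne
      · have hpc := (hg.isParent_iff_of_mem_gap hh).1 hpc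
        obtain rfl := hg.letterDisjoint_gap hpc.1.1 hc.mem
        exact ⟨rfl, .inr ⟨⟨h, hpa, hpc⟩, t, (hasType_a t).1 hta, (hasType_c t).1 htc⟩⟩
  · rintro ⟨rfl, ⟨h, -⟩ | ⟨⟨h, hpa, hpc⟩, t, hta, htc⟩⟩
    · exact absurd h ha.not_isLevelOne
    · have hh := hpa.1.right_mem
      exact .inr ⟨⟨h, (hg.isParent_iff_of_mem_gap hh).2 hpa, (hg.isParent_iff_of_mem_gap hh).2 hpc⟩,
        t, (hasType_a t).2 hta, (hasType_c t).2 htc⟩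

lemma kOcc_two (hg : IsForest g) (s : Fin (k - 1)) (p : PermPattern) :
    kOcc (forestWord g) 2 (s + 1) p = ∑ i, kOccOne ((g i).gap s) p :=
  ncard_isBlockOcc_eq_sum (fun i => hg.isSegment_gap i s) (fun _ _ _ hi hj => (hg.gap_inj hi hj).1)
    (fun _ => hg.isLevel_two_and_hasType) (fun _ _ ha => ha.mem)
    (fun _ _ _ _ ha hc => hg.kSibling_iff_of_isLevel_one ha hc) p

lemma kOcc_add_three (hg : IsForest g) (ℓ t : ℕ) (p : PermPattern) :
    kOcc (forestWord g) (ℓ + 3) t p = ∑ i, ∑ s, kOcc ((g i).gap s) (ℓ + 2) t p := by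
  have hP (a : ℕ) : (IsLevel (forestWord g) (ℓ + 3) a ∧ HasType (forestWord g) a t) ↔
      ∃ q : Fin m × Fin (k - 1),
        IsLevel ((g q.1).gap q.2) (ℓ + 2) a ∧ HasType ((g q.1).gap q.2) a t := by
    rw [hg.isLevel_add_three_and_hasType, Prod.exists]
  rw [← Fintype.sum_prod_type', kOcc, ncard_isBlockOcc_eq_sum
    (fun q => hg.isSegment_gap q.1 q.2) hg.letterDisjoint_gap hP (fun _ _ ha => ha.1.mem)
    fun _ _ _ _ ha hc => hg.kSibling_iff_of_isLevel_add_two ha.1 hc.1]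
  rfl

lemma idxOf_root (hg : IsForest g) (i : Fin m) :
    (forestWord g).idxOf (g i).root = (prefixFn (fun i => (g i).word) i).length := by
  have hroot : (g i).root ∉ prefixFn (fun i => (g i).word) i := by
    intro h
    obtain ⟨j, hj, h⟩ := mem_prefixFn.1 h
    obtain rfl := hg.disjoint RootedBlock.root_mem_word h
    exact lt_irrefl _ hj
  rw [forestWord, concatFn_eq_append _ i, List.append_assoc, List.idxOf_append_of_notMem hroot,
    RootedBlock.word, List.cons_append, List.idxOf_cons_self, add_zero]

lemma idxOf_root_lt_iff (hg : IsForest g) {i j : Fin m} :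
    (forestWord g).idxOf (g i).root < (forestWord g).idxOf (g j).root ↔ i < j := by
  rw [hg.idxOf_root, hg.idxOf_root]
  exact (strictMono_length_prefixFn fun i => List.cons_ne_nil _ _).lt_iff_lt
    (a := i.castSucc) (b := j.castSucc)

lemma idxOf_root_eq_add_iff (hg : IsForest g) {i j : Fin m} :
    (forestWord g).idxOf (g j).root =
        (forestWord g).idxOf (g i).root + (block (forestWord g) (g i).root).length ↔
      (j : ℕ) = i + 1 := by
  rw [hg.idxOf_root, hg.idxOf_root, hg.block_root, ← List.length_append,
    ← prefixFn_succ (fun i => (g i).word) i]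
  refine ((strictMono_length_prefixFn fun i => List.cons_ne_nil _ _).injective.eq_iff
    (a := j.castSucc) (b := i.succ)).trans ?_
  rw [Fin.ext_iff, Fin.val_castSucc, Fin.val_succ]

lemma isBlockOcc_root_iff (hg : IsForest g) (p : PermPattern) (i : Fin p.len → Fin m) :
    IsBlockOcc (KSibling (forestWord g)) (forestWord g) p (fun a => (g (i a)).root) ↔
      p.IsOcc (fun i => (g i).root) i := by
  have isLevel_root (j) : IsLevel (forestWord g) 1 (g j).root := hg.isLevel_one.2 ⟨j, rfl⟩
  have kSibling_root (j l) : KSibling (forestWord g) (g j).root (g l).root :=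
    .inl ⟨isLevel_root j, isLevel_root l⟩
  simp only [IsBlockOcc, PermPattern.IsOcc, StrictMono, root_mem_forestWord, kSibling_root,
    hg.idxOf_root_lt_iff, hg.idxOf_root_eq_add_iff, implies_true, true_and]

lemma kOccOne_eq_numOcc (hg : IsForest g) (p : PermPattern) :
    kOccOne (forestWord g) p = p.numOcc fun i => (g i).root := by
  have hinj : Function.Injective fun (i : Fin p.len → Fin m) a => (g (i a)).root :=
    fun i j h => funext fun a => hg.root_injective (congrFun h a)
  rw [kOccOne, PermPattern.numOcc, ← Set.ncard_image_of_injective _ hinj]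
  congr 1
  ext b
  simp only [Set.mem_ofPred_eq, Set.mem_image]
  constructor
  · rintro ⟨hb, hlevel⟩
    choose i hi using fun a => hg.isLevel_one.1 (hlevel a)
    obtain rfl : b = fun a => (g (i a)).root := funext hi
    exact ⟨i, (hg.isBlockOcc_root_iff p i).1 hb, rfl⟩
  · rintro ⟨i, hi, rfl⟩
    exact ⟨(hg.isBlockOcc_root_iff p i).2 hi, fun a => hg.isLevel_one.2 ⟨i a, rfl⟩⟩

end IsForest

/-! ### The weight of a forest -/

/-- The conditions on a word in the definition of `kStirlingAvoiding`. -/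
def AvoidsBlockPatterns {k : ℕ} (A : TupleSeq k (Set PermPattern)) (σ : List ℕ) : Prop :=
  (∀ a ∈ A.head, kOccOne σ a = 0) ∧
    ∀ (i : ℕ) (j : Fin (k - 1)), ∀ a ∈ A.tail i j, kOcc σ (i + 2) (j + 1) a = 0

lemma kOcc_eq_zero {σ : List ℕ} {ℓ t : ℕ} {p : PermPattern} (h : σ.length < ℓ) :
    kOcc σ ℓ t p = 0 := by
  by_contra hne
  obtain ⟨b, hb⟩ := Set.nonempty_of_ncard_ne_zero hne
  exact (hb.2 ⟨0, hb.1.1⟩).1.le_length.not_gt h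

lemma numBlocksOfType_eq_zero {σ : List ℕ} {ℓ t : ℕ} (h : σ.length < ℓ) :
    numBlocksOfType σ ℓ t = 0 := by
  by_contra hne
  obtain ⟨a, ha⟩ := Set.nonempty_of_ncard_ne_zero hne
  exact ha.1.le_length.not_gt h

section Weight

variable {R : Type*} [CommRing R] {k : ℕ}

lemma kWeight_eq_prod_range (p : TupleSeq k PermPattern) (x y : TupleSeq k R)
    {σ : List ℕ} {N : ℕ} (hN : σ.length ≤ N) :
    kWeight k p x y σ = x.head ^ kOccOne σ p.head * y.head ^ numBlocks σ 1 *
      ∏ i ∈ Finset.range N, ∏ j : Fin (k - 1),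
        x.tail i j ^ kOcc σ (i + 2) (j + 1) (p.tail i j) *
          y.tail i j ^ numBlocksOfType σ (i + 2) (j + 1) := by
  rw [kWeight, finprod_eq_prod_of_mulSupport_subset]
  intro i hi
  rw [Finset.coe_range, Set.mem_Iio]
  by_contra hle
  refine hi (Finset.prod_eq_one fun j _ => ?_)
  rw [kOcc_eq_zero (by lia), numBlocksOfType_eq_zero (by lia), pow_zero, pow_zero, mul_one]

open Classical in
/-- The contribution of the word `σ` to the coefficients of `kStirlingEGF`. -/
noncomputable def avoidingWeight (A : TupleSeq k (Set PermPattern))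
    (p : TupleSeq k PermPattern) (x y : TupleSeq k R) (σ : List ℕ) : R :=
  if AvoidsBlockPatterns A σ then kWeight k p x y σ else 0

lemma sum_kStirlingAvoiding (n : ℕ) (A : TupleSeq k (Set PermPattern))
    (p : TupleSeq k PermPattern) (x y : TupleSeq k R) :
    ∑ σ ∈ kStirlingAvoiding k n A, kWeight k p x y σ =
      ∑ σ ∈ kStirling k n, avoidingWeight A p x y σ := by
  rw [kStirlingAvoiding, Finset.sum_filter]
  refine Finset.sum_congr rfl fun σ _ => ?_
  rw [avoidingWeight]
  congr

lemma prod_comm_pairs {ι κ α β : Type*} (s : Finset ι) (t : Finset κ) (u : Finset α)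
    (v : Finset β) (f : ι → κ → α → β → R) :
    ∏ a ∈ s, ∏ b ∈ t, ∏ c ∈ u, ∏ d ∈ v, f a b c d =
      ∏ c ∈ u, ∏ d ∈ v, ∏ a ∈ s, ∏ b ∈ t, f a b c d := by
  simp_rw [← Finset.prod_product' s t, ← Finset.prod_product' u v]
  exact Finset.prod_comm

namespace IsForest

variable {m : ℕ} {g : Fin m → RootedBlock k}

lemma avoidsBlockPatterns_iff (hg : IsForest g) (A : TupleSeq k (Set PermPattern)) :
    AvoidsBlockPatterns A (forestWord g) ↔
      (∀ a ∈ A.head, a.numOcc (fun i => (g i).root) = 0) ∧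
        ∀ i s, AvoidsBlockPatterns (A.shift s) ((g i).gap s) := by
  simp only [AvoidsBlockPatterns, hg.kOccOne_eq_numOcc, TupleSeq.shift]
  refine and_congr_right fun _ => ⟨fun h i s => ⟨fun a ha => ?_, fun ℓ j a ha => ?_⟩,
    fun h ℓ j a ha => ?_⟩
  · have hsum := h 0 s a ha
    rw [hg.kOcc_two, Finset.sum_eq_zero_iff] at hsum
    exact hsum i (Finset.mem_univ i)
  · have hsum := h (ℓ + 1) j a ha
    rw [hg.kOcc_add_three, Finset.sum_eq_zero_iff] at hsum
    exact Finset.sum_eq_zero_iff.1 (hsum i (Finset.mem_univ i)) s (Finset.mem_univ s)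
  · cases ℓ with
    | zero =>
      rw [hg.kOcc_two]
      exact Finset.sum_eq_zero fun i _ => (h i j).1 a ha
    | succ ℓ =>
      rw [hg.kOcc_add_three]
      exact Finset.sum_eq_zero fun i _ => Finset.sum_eq_zero fun s _ => (h i s).2 ℓ j a ha

lemma kWeight_eq (hg : IsForest g) (p : TupleSeq k PermPattern) (x y : TupleSeq k R) :
    kWeight k p x y (forestWord g) =
      x.head ^ p.head.numOcc (fun i => (g i).root) * y.head ^ m *
        ∏ i, ∏ s, kWeight k (p.shift s) (x.shift s) (y.shift s) ((g i).gap s) := by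
  have kWeight_gap (i s) := kWeight_eq_prod_range (p.shift s) (x.shift s) (y.shift s)
    (hg.isSegment_gap i s).isInfix.length_le
  rw [kWeight_eq_prod_range p x y (Nat.le_succ (forestWord g).length), hg.kOccOne_eq_numOcc,
    hg.numBlocks_one, Finset.prod_range_succ', mul_comm (∏ _ ∈ _, _)]
  simp only [kWeight_gap]
  simp only [TupleSeq.shift, zero_add, hg.kOcc_two, hg.numBlocksOfType_two, add_right_comm _ 1 2,
    hg.kOcc_add_three, hg.numBlocksOfType_add_three]
  simp only [Finset.prod_mul_distrib, ← Finset.prod_pow_eq_pow_sum]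
  congr 2
  · exact congrArg₂ (· * ·) Finset.prod_comm Finset.prod_comm
  · exact congrArg₂ (· * ·) (prod_comm_pairs ..) (prod_comm_pairs ..)

lemma avoidingWeight_eq (hg : IsForest g) (A : TupleSeq k (Set PermPattern))
    (p : TupleSeq k PermPattern) (x y : TupleSeq k R) :
    avoidingWeight A p x y (forestWord g) =
      patternWeight A.head p.head x.head (fun i => (g i).root) * y.head ^ m *
        ∏ i, ∏ s, avoidingWeight (A.shift s) (p.shift s) (x.shift s) (y.shift s)
          ((g i).gap s) := by
  classical
  simp only [avoidingWeight, patternWeight, Finset.prod_ite_zero, ite_mul, zero_mul, mul_ite,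
    mul_zero, Finset.mem_univ, true_imp_iff, hg.avoidsBlockPatterns_iff, hg.kWeight_eq, ite_and]
  split_ifs <;> rfl

end IsForest

lemma avoidingWeight_nil (A : TupleSeq k (Set PermPattern)) (p : TupleSeq k PermPattern)
    (x y : TupleSeq k R) : avoidingWeight A p x y [] = 1 := by
  have hg : IsForest (Fin.elim0 : Fin 0 → RootedBlock k) := ⟨fun i => i.elim0, fun _ i => i.elim0⟩
  have hweight := hg.avoidingWeight_eq A p x y
  rwa [forestWord, concatFn_zero, patternWeight_fin_zero, pow_zero, Fintype.prod_empty, mul_one,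
    mul_one] at hweight

end Weight

/-! ### Decomposition of Stirling words into blocks -/

section Decomposition

variable {k m : ℕ} {S : Finset ℕ}

lemma mem_families_stirlingWords (hk : 1 ≤ k) {w : Fin m → List ℕ} :
    w ∈ families (fun _ => stirlingWords k) S ↔
      (∀ s, IsKStirling k (w s)) ∧ LetterDisjoint w ∧ ∀ a, a ∈ S ↔ ∃ s, a ∈ w s := by
  rw [mem_families fun _ => toFinset_eq_of_mem_stirlingWords hk]
  simp only [mem_stirlingWords hk, and_true, List.mem_toFinset]
  rfl

open Classical in
/-- The blocks that are `k`-Stirling words with set of letters `S`. The root is the least letter,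
and the gaps partition the other letters. -/
noncomputable def stirlingBlocks (k : ℕ) (S : Finset ℕ) : Finset (RootedBlock k) :=
  if hS : S.Nonempty then
    (families (fun _ => stirlingWords k) (S.erase (S.min' hS))).map
      ⟨RootedBlock.mk (S.min' hS), fun _ _ h => (RootedBlock.mk.inj h).2⟩
  else ∅

lemma RootedBlock.IsStirling.min'_toFinset_word {q : RootedBlock k} (hq : q.IsStirling)
    (h : q.word.toFinset.Nonempty) : q.word.toFinset.min' h = q.root := by
  refine le_antisymm (Finset.min'_le _ _ (List.mem_toFinset.2 root_mem_word))
    (Finset.le_min' _ _ _ fun a ha => ?_)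
  rcases mem_word.1 (List.mem_toFinset.1 ha) with rfl | ⟨s, hs⟩
  · exact le_rfl
  · exact (hq.root_lt s a hs).le

lemma mem_stirlingBlocks (hk : 1 ≤ k) {q : RootedBlock k} :
    q ∈ stirlingBlocks k S ↔ q.IsStirling ∧ q.word.toFinset = S := by
  constructor
  · intro hq
    rw [stirlingBlocks] at hq
    split_ifs at hq with hS
    · obtain ⟨w, hw, rfl⟩ := Finset.mem_map.1 hq
      obtain ⟨hstirling, hdisj, hcover⟩ := (mem_families_stirlingWords hk).1 hw
      refine ⟨⟨fun s a ha => S.min'_lt_of_mem_erase_min' hS ((hcover a).2 ⟨s, ha⟩), hdisj,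
        hstirling⟩, Finset.ext fun a => ?_⟩
      have mem_iff : a ∈ S ↔ a = S.min' hS ∨ a ∈ S.erase (S.min' hS) := by
        rw [← Finset.mem_insert, Finset.insert_erase (S.min'_mem hS)]
      rw [List.mem_toFinset, mem_iff, hcover]
      exact RootedBlock.mem_word
    · exact absurd hq (Finset.notMem_empty q)
  · rintro ⟨hq, rfl⟩
    have hne : q.word.toFinset.Nonempty := ⟨q.root, List.mem_toFinset.2 RootedBlock.root_mem_word⟩
    rw [stirlingBlocks, dif_pos hne, Finset.mem_map]
    refine ⟨q.gap, (mem_families_stirlingWords hk).2 ⟨hq.gap_isKStirling, hq.disjoint, fun a => ?_⟩,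
      RootedBlock.ext (hq.min'_toFinset_word hne) rfl⟩
    rw [hq.min'_toFinset_word, Finset.mem_erase, List.mem_toFinset, RootedBlock.mem_word]
    exact ⟨fun h => h.2.resolve_left h.1, fun ⟨s, hs⟩ => ⟨(hq.root_lt s a hs).ne', .inr ⟨s, hs⟩⟩⟩

lemma mem_families_stirlingBlocks (hk : 1 ≤ k) {g : Fin m → RootedBlock k} :
    g ∈ families (fun _ => stirlingBlocks k) S ↔
      IsStirlingForest g ∧ (forestWord g).toFinset = S := by
  rw [mem_families (supp := fun q => q.word.toFinset)
    fun _ _ q hq => ((mem_stirlingBlocks hk).1 hq).2]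
  simp only [mem_stirlingBlocks hk, and_true, List.mem_toFinset, ← mem_forestWord]
  rw [← and_assoc, eq_comm, Finset.ext_iff]
  simp only [List.mem_toFinset]
  exact and_congr_left fun _ => ⟨fun h => ⟨h.1, h.2⟩, fun h => ⟨h.isStirling, h.disjoint⟩⟩

lemma IsForest.le_card_toFinset_forestWord {g : Fin m → RootedBlock k} (hg : IsForest g) :
    m ≤ (forestWord g).toFinset.card := by
  calc m = (Finset.univ.image fun i => (g i).root).card := by
        rw [Finset.card_image_of_injective _ hg.root_injective, Finset.card_univ, Fintype.card_fin]
    _ ≤ (forestWord g).toFinset.card :=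
        Finset.card_le_card (Finset.image_subset_iff.2 fun i _ =>
          List.mem_toFinset.2 (mem_forestWord.2 ⟨i, RootedBlock.root_mem_word⟩))

lemma sum_stirlingWords {M : Type*} [AddCommMonoid M] (hk : 1 ≤ k) (S : Finset ℕ)
    (f : List ℕ → M) :
    ∑ σ ∈ stirlingWords k S, f σ = ∑ m ∈ Finset.range (S.card + 1),
      ∑ g ∈ families (fun _ : Fin m => stirlingBlocks k) S, f (forestWord g) := by
  rw [Finset.sum_sigma']
  symm
  refine Finset.sum_nbij (fun x => forestWord x.2) (fun x hx => ?_) (fun x hx x' hx' h => ?_)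
    (fun σ hσ => ?_) fun _ _ => rfl
  · obtain ⟨hg, hS⟩ := (mem_families_stirlingBlocks hk).1 (Finset.mem_sigma.1 hx).2
    exact (mem_stirlingWords hk).2 ⟨hg.isKStirling_forestWord hk, hS⟩
  · have hg := ((mem_families_stirlingBlocks hk).1 (Finset.mem_sigma.1 hx).2).1
    have hg' := ((mem_families_stirlingBlocks hk).1 (Finset.mem_sigma.1 hx').2).1
    exact List.ofFn_inj'.1 (ofFn_eq_of_forestWord_eq hg.isForest hg'.isForest h)
  · obtain ⟨hσ, hS⟩ := (mem_stirlingWords hk).1 hσ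
    obtain ⟨m, g, hg, rfl⟩ := hσ.exists_forestWord_eq
    refine ⟨⟨m, g⟩, Finset.mem_coe.2 (Finset.mem_sigma.2 ⟨?_, ?_⟩), rfl⟩
    · exact Finset.mem_range_succ_iff.2 (hS ▸ hg.isForest.le_card_toFinset_forestWord)
    · exact (mem_families_stirlingBlocks hk).2 ⟨hg, hS⟩

end Decomposition

/-! ### The functional equation -/

section FunctionalEquation

variable {R : Type*} [CommRing R] [Algebra ℚ R] {k : ℕ}

lemma sum_stirlingBlocks (hk : 1 ≤ k) (W : Fin (k - 1) → List ℕ → R) (G : Fin (k - 1) → R⟦X⟧)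
    (S : Finset ℕ) (hG : ∀ s, ∀ T : Finset ℕ, T.card < S.card →
      ∑ σ ∈ stirlingWords k T, W s σ = egfCoeff (G s) T.card) :
    ∑ q ∈ stirlingBlocks k S, ∏ s, W s (q.gap s) =
      egfCoeff (formalIntegral (∏ s, G s)) S.card := by
  rw [stirlingBlocks]
  split_ifs with hS
  · have hmin := S.min'_mem hS
    rw [Finset.sum_map, ← Finset.card_erase_add_one hmin, egfCoeff_formalIntegral_succ]
    exact sum_families (fun _ => toFinset_eq_of_mem_stirlingWords hk) W G fun s T hT =>
      hG s T ((Finset.card_le_card hT).trans_lt (Finset.card_erase_lt_of_mem hmin))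
  · rw [Finset.not_nonempty_iff_eq_empty.1 hS, Finset.sum_empty, Finset.card_empty,
      egfCoeff_formalIntegral_zero]

variable (A : TupleSeq k (Set PermPattern)) (p : TupleSeq k PermPattern) (x y : TupleSeq k R)

lemma sum_avoidingWeight_eq_egfCoeff_subst (hk : 1 ≤ k) (G : Fin (k - 1) → R⟦X⟧) (S : Finset ℕ)
    (hG : ∀ s, ∀ T : Finset ℕ, T.card < S.card →
      ∑ σ ∈ stirlingWords k T, avoidingWeight (A.shift s) (p.shift s) (x.shift s) (y.shift s) σ =
        egfCoeff (G s) T.card) :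
    ∑ σ ∈ stirlingWords k S, avoidingWeight A p x y σ =
      egfCoeff ((permEGF A.head p.head x.head).subst
        (PowerSeries.C y.head * formalIntegral (∏ s, G s))) S.card := by
  let v (q : RootedBlock k) : R :=
    ∏ s, avoidingWeight (A.shift s) (p.shift s) (x.shift s) (y.shift s) (q.gap s)
  rw [sum_stirlingWords hk, egfCoeff_subst_C_mul _ (constantCoeff_formalIntegral _)]
  refine Finset.sum_congr rfl fun m _ => ?_
  have isForest_of_mem {g} (hg : g ∈ families (fun _ : Fin m => stirlingBlocks k) S) : IsForest g :=
    ((mem_families_stirlingBlocks hk).1 hg).1.isForest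
  have sum_prod_v : ∑ g ∈ families (fun _ : Fin m => stirlingBlocks k) S, ∏ i, v (g i) =
      egfCoeff (formalIntegral (∏ s, G s) ^ m) S.card := by
    rw [← Fin.prod_const]
    exact sum_families (supp := fun q => q.word.toFinset)
      (fun _ _ q hq => ((mem_stirlingBlocks hk).1 hq).2) (fun _ => v) _ fun _ T hT =>
        sum_stirlingBlocks hk _ G T fun s U hU => hG s U (hU.trans_le (Finset.card_le_card hT))
  calc ∑ g ∈ families (fun _ : Fin m => stirlingBlocks k) S, avoidingWeight A p x y (forestWord g)
      = y.head ^ m * ∑ g ∈ families (fun _ : Fin m => stirlingBlocks k) S,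
          patternWeight A.head p.head x.head (fun i => (g i).root) * ∏ i, v (g i) := by
        rw [Finset.mul_sum]
        refine Finset.sum_congr rfl fun g hg => ?_
        rw [(isForest_of_mem hg).avoidingWeight_eq, mul_left_comm, mul_assoc]
    _ = _ := by
        rw [sum_families_patternWeight _ _ _ _ _ _ fun g hg => (isForest_of_mem hg).root_injective,
          sum_prod_v, mul_left_comm]

lemma egfCoeff_kStirlingEGF (n : ℕ) :
    egfCoeff (kStirlingEGF k A p x y) n = ∑ σ ∈ kStirling k n, avoidingWeight A p x y σ := by
  simp only [kStirlingEGF, sum_kStirlingAvoiding]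
  refine egfCoeff_mk_ite ?_ n
  have kStirling_zero : kStirling k 0 = {[]} := by
    simp [kStirling, sortedWord, Finset.filter_singleton, isStirlingWord_iff_avoids212, Avoids212]
  rw [kStirling_zero, Finset.sum_singleton, avoidingWeight_nil]

lemma sum_avoidingWeight_eq_egfCoeff_kStirlingEGF (hk : 1 ≤ k) (S : Finset ℕ) :
    ∑ σ ∈ stirlingWords k S, avoidingWeight A p x y σ =
      egfCoeff (kStirlingEGF k A p x y) S.card := by
  induction hn : S.card using Nat.strong_induction_on generalizing S A p x y with
  | _ n ih =>
    subst hn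
    have hG : ∀ s, ∀ T : Finset ℕ, T.card < S.card →
        ∑ σ ∈ stirlingWords k T,
          avoidingWeight (A.shift s) (p.shift s) (x.shift s) (y.shift s) σ =
            egfCoeff (kStirlingEGF k (A.shift s) (p.shift s) (x.shift s) (y.shift s)) T.card :=
      fun s T hT => ih T.card hT _ _ _ _ T rfl
    rw [sum_avoidingWeight_eq_egfCoeff_subst A p x y hk _ S hG, egfCoeff_kStirlingEGF,
      kStirling_eq_stirlingWords, sum_avoidingWeight_eq_egfCoeff_subst A p x y hk _
        (Finset.Icc 1 S.card) (by simpa using hG), Nat.card_Icc, Nat.add_sub_cancel]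

theorem kStirlingEGF_eq_subst (hk : 1 ≤ k) :
    kStirlingEGF k A p x y =
      (permEGF A.head p.head x.head).subst
        (PowerSeries.C y.head * formalIntegral
          (∏ j : Fin (k - 1),
            kStirlingEGF k (A.shift j) (p.shift j) (x.shift j) (y.shift j))) := by
  refine ext_egfCoeff fun n => ?_
  rw [egfCoeff_kStirlingEGF, kStirling_eq_stirlingWords,
    sum_avoidingWeight_eq_egfCoeff_subst A p x y hk _ _ fun j T _ =>
      sum_avoidingWeight_eq_egfCoeff_kStirlingEGF _ _ _ _ hk T,
    Nat.card_Icc, Nat.add_sub_cancel]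

end FunctionalEquation

/-! ### Stirling permutations -/

section Stirling

lemma BlockSub.exists_eq_append_cons {σ : List ℕ} {a c : ℕ} (h : BlockSub σ a c) :
    ∃ x y, σ = x ++ a :: y ∧ a ∉ x ∧ c ∈ x ∧ c ∈ y := by
  obtain ⟨u', v', hσ', hu', hv', -⟩ := exists_eq_append_block_append h.1
  obtain ⟨u, v, hσ, -, -, hhead, hlast⟩ := exists_eq_append_block_append h.right_mem
  have count_le : σ.count a ≤ (block σ c).count a := by
    have hcount := congrArg (List.count a) hσ'
    rw [List.count_append, List.count_append, List.count_eq_zero_of_not_mem hu',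
      List.count_eq_zero_of_not_mem hv', zero_add, add_zero] at hcount
    exact hcount.trans_le (h.2.2.sublist.count_le a)
  have hau : a ∉ u := by
    rw [hσ, List.count_append, List.count_append] at count_le
    exact List.count_eq_zero.1 (by lia)
  obtain ⟨x, y, hxy, hx⟩ := List.eq_append_cons_of_mem h.mem_block
  refine ⟨u ++ x, y ++ v, by rw [hσ, hxy]; simp, ?_, ?_, ?_⟩
  · simp [hau, hx]
  · cases x with
    | nil =>
      rw [hxy] at hhead
      exact absurd (Option.some.inj hhead) h.2.1
    | cons b x =>
      rw [hxy] at hhead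
      exact List.mem_append_right u (Option.some.inj hhead ▸ List.mem_cons_self)
  · rw [hxy, List.getLast?_append_cons] at hlast
    exact List.mem_append_left v
      ((List.mem_cons.1 (List.mem_of_getLast? hlast)).resolve_left h.2.1.symm)

lemma IsKStirling.count_takeWhile_eq_one {σ : List ℕ} (hσ : IsKStirling 2 σ) {a c : ℕ}
    (h : BlockSub σ a c) : (σ.takeWhile (· ≠ a)).count c = 1 := by
  have hcount := hσ.count_eq c h.right_mem
  obtain ⟨x, y, rfl, hx, hcx, hcy⟩ := h.exists_eq_append_cons
  rw [List.takeWhile_append_of_pos (decide_ne_of_notMem hx),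
    List.takeWhile_cons_of_neg (by simp), List.append_nil]
  rw [List.count_append, List.count_cons_of_ne h.2.1] at hcount
  have := List.count_pos_iff.2 hcx
  have := List.count_pos_iff.2 hcy
  lia

lemma isKStirling_of_mem_kStirling {k n : ℕ} (hk : 1 ≤ k) {σ : List ℕ} (hσ : σ ∈ kStirling k n) :
    IsKStirling k σ := by
  rw [kStirling_eq_stirlingWords, mem_stirlingWords hk] at hσ
  exact hσ.1

lemma isBlockOcc_congr {σ : List ℕ} {sib sib' : ℕ → ℕ → Prop} {p : PermPattern}
    {b : Fin p.len → ℕ} (h : ∀ a c, sib (b a) (b c) ↔ sib' (b a) (b c)) :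
    IsBlockOcc sib σ p b ↔ IsBlockOcc sib' σ p b := by
  simp only [IsBlockOcc, h]

lemma kOccOne_eq_levelOcc (σ : List ℕ) (p : PermPattern) : kOccOne σ p = levelOcc σ 1 p := by
  refine congrArg Set.ncard (Set.ext fun b => and_congr_left fun h =>
    isBlockOcc_congr fun a c => ?_)
  exact ⟨fun _ => .inl ⟨h a, h c⟩, fun _ => .inl ⟨h a, h c⟩⟩

lemma levelOcc_eq_zero {σ : List ℕ} {ℓ : ℕ} {p : PermPattern} (h : σ.length < ℓ) :
    levelOcc σ ℓ p = 0 := by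
  by_contra hne
  obtain ⟨b, hb⟩ := Set.nonempty_of_ncard_ne_zero hne
  exact (hb.2 ⟨0, hb.1.1⟩).le_length.not_gt h

lemma numBlocks_eq_zero {σ : List ℕ} {ℓ : ℕ} (h : σ.length < ℓ) : numBlocks σ ℓ = 0 := by
  by_contra hne
  obtain ⟨a, ha⟩ := Set.nonempty_of_ncard_ne_zero hne
  exact ha.le_length.not_gt h

namespace IsKStirling

variable {σ : List ℕ} (hσ : IsKStirling 2 σ)
include hσ

lemma hasType_one {a ℓ : ℕ} (ha : IsLevel σ (ℓ + 2) a) : HasType σ a 1 := by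
  obtain ⟨c, -, hc, hsub, -⟩ := id ha
  exact ⟨c, ⟨hsub, _, hc, ha⟩, hσ.count_takeWhile_eq_one hsub⟩

lemma numBlocksOfType_one (ℓ : ℕ) : numBlocksOfType σ (ℓ + 2) 1 = numBlocks σ (ℓ + 2) :=
  congrArg Set.ncard (Set.ext fun _ => and_iff_left_of_imp hσ.hasType_one)

lemma kOcc_one (ℓ : ℕ) (p : PermPattern) : kOcc σ (ℓ + 2) 1 p = levelOcc σ (ℓ + 2) p := by
  refine congrArg Set.ncard (Set.ext fun b => ?_)
  simp only [Set.mem_ofPred_eq, and_iff_left_of_imp hσ.hasType_one]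
  refine and_congr_left fun h => isBlockOcc_congr fun a c => or_congr_right ?_
  exact and_iff_left_of_imp fun _ => ⟨1, hσ.hasType_one (h a), hσ.hasType_one (h c)⟩

lemma avoidsBlockPatterns_ofSeq_iff (A : ℕ → Set PermPattern) :
    AvoidsBlockPatterns (TupleSeq.ofSeq A) σ ↔ ∀ i, ∀ a ∈ A i, levelOcc σ (i + 1) a = 0 := by
  have forall_fin_one {P : Fin (2 - 1) → Prop} : (∀ j, P j) ↔ P 0 := Fin.forall_fin_one
  simp only [AvoidsBlockPatterns, TupleSeq.ofSeq, forall_fin_one, Fin.val_zero, zero_add,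
    hσ.kOcc_one, kOccOne_eq_levelOcc]
  exact (Nat.and_forall_add_one (p := fun i => ∀ a ∈ A i, levelOcc σ (i + 1) a = 0))

lemma kWeight_ofSeq {R : Type*} [CommRing R] (p : ℕ → PermPattern) (x y : ℕ → R) :
    kWeight 2 (TupleSeq.ofSeq p) (TupleSeq.ofSeq x) (TupleSeq.ofSeq y) σ =
      ∏ᶠ i : ℕ, x i ^ levelOcc σ (i + 1) (p i) * y i ^ numBlocks σ (i + 1) := by
  have prod_fin_one (f : Fin (2 - 1) → R) : ∏ j, f j = f 0 := Fin.prod_univ_one f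
  rw [kWeight_eq_prod_range _ _ _ le_rfl,
    finprod_eq_prod_of_mulSupport_subset (s := Finset.range (σ.length + 1)),
    Finset.prod_range_succ', mul_comm]
  · simp only [TupleSeq.ofSeq, prod_fin_one, Fin.val_zero, zero_add, hσ.kOcc_one,
      hσ.numBlocksOfType_one, kOccOne_eq_levelOcc, add_assoc, one_add_one_eq_two]
  · intro i hi
    rw [Finset.coe_range, Set.mem_Iio]
    by_contra hle
    refine hi ?_
    beta_reduce
    rw [levelOcc_eq_zero (by lia), numBlocks_eq_zero (by lia), pow_zero, pow_zero, mul_one]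

end IsKStirling

lemma sum_stirlingAvoiding_eq {R : Type*} [CommRing R] (n : ℕ) (A : ℕ → Set PermPattern)
    (p : ℕ → PermPattern) (x y : ℕ → R) :
    ∑ σ ∈ stirlingAvoiding n A,
        ∏ᶠ i : ℕ, x i ^ levelOcc σ (i + 1) (p i) * y i ^ numBlocks σ (i + 1) =
      ∑ σ ∈ kStirlingAvoiding 2 n (TupleSeq.ofSeq A),
        kWeight 2 (TupleSeq.ofSeq p) (TupleSeq.ofSeq x) (TupleSeq.ofSeq y) σ := by
  rw [stirlingAvoiding, kStirlingAvoiding, Finset.sum_filter, Finset.sum_filter]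
  refine Finset.sum_congr rfl fun σ hσ => ?_
  have hσ := isKStirling_of_mem_kStirling one_le_two hσ
  rw [hσ.kWeight_ofSeq]
  classical exact if_congr (hσ.avoidsBlockPatterns_ofSeq_iff A).symm rfl rfl

lemma stirlingEGF_eq_kStirlingEGF {R : Type*} [CommRing R] [Algebra ℚ R]
    (A : ℕ → Set PermPattern) (p : ℕ → PermPattern) (x y : ℕ → R) :
    stirlingEGF A p x y = kStirlingEGF 2 (TupleSeq.ofSeq A) (TupleSeq.ofSeq p)
      (TupleSeq.ofSeq x) (TupleSeq.ofSeq y) := by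
  simp only [stirlingEGF, kStirlingEGF, sum_stirlingAvoiding_eq]

end Stirling

theorem theorem4 {R : Type*} [CommRing R] [Algebra ℚ R] :
    (∀ (k : ℕ) (_ : 1 ≤ k) (A : TupleSeq k (Set PermPattern)) (p : TupleSeq k PermPattern)
        (x y : TupleSeq k R),
      kStirlingEGF k A p x y =
        (permEGF A.head p.head x.head).subst
          (PowerSeries.C y.head * formalIntegral
            (∏ j : Fin (k - 1),
              kStirlingEGF k (A.shift j) (p.shift j) (x.shift j) (y.shift j)))) ∧
    (∀ (A : ℕ → Set PermPattern) (p : ℕ → PermPattern) (x y : ℕ → R),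
      stirlingEGF A p x y =
          kStirlingEGF 2 (TupleSeq.ofSeq A) (TupleSeq.ofSeq p)
            (TupleSeq.ofSeq x) (TupleSeq.ofSeq y) ∧
      stirlingEGF A p x y =
        (permEGF (A 0) (p 0) (x 0)).subst
          (PowerSeries.C (y 0) * formalIntegral
            (stirlingEGF (fun i => A (i + 1)) (fun i => p (i + 1))
              (fun i => x (i + 1)) (fun i => y (i + 1))))) := by
  refine ⟨fun k hk A p x y => kStirlingEGF_eq_subst A p x y hk,
    fun A p x y => ⟨stirlingEGF_eq_kStirlingEGF A p x y, ?_⟩⟩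
  have prod_fin_one (G : Fin (2 - 1) → R⟦X⟧) : ∏ j, G j = G 0 := Fin.prod_univ_one G
  rw [stirlingEGF_eq_kStirlingEGF, kStirlingEGF_eq_subst _ _ _ _ one_le_two, prod_fin_one,
    stirlingEGF_eq_kStirlingEGF]
  rfl
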